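/- Let $G$ be a finite simple plane graph (not necessarily connected) with minimum degree $5$. For $\kappa_1,\dots,\kappa_5\in\mathbb{N}\cup\{\infty\}$, a $\langle \kappa_1,\kappa_2,\kappa_3,\kappa_4,\kappa_5\rangle$-star in $G$ is a star consisting of a vertex $v$ of degree $5$ together with its five neighbors, which can be labelled $v_1,\dots,v_5$ in the (clockwise or counterclockwise) cyclic order around $v$ in such a way that $\deg_G(v_i)\le\kappa_i$ for $i=1,\dots,5$. A minor $5$-star in $G$ is a star with five rays whose center has degree at most $5$ in $G$. The weight of a star is the sum, and its height is the maximum, of the degrees in $G$ of its six vertices (the center included). If $G$ contains no $\langle 5,6,6,5,\infty\rangle$-star and no $\langle 5,6,7,5,23\rangle$-star, then $G$ contains a minor $5$-star whose weight is at most $45$ and whose height is at most $17$. -/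

import Mathlib

namespace PlaneStar

/-- A rotation system on a simple graph `G`: for every vertex, a cyclic order of the edges at that
vertex. A dart is an edge together with an orientation; `next` maps a dart to the next dart with the
same initial vertex, and the darts at one vertex form a single cycle. -/
structure RotationSystem {V : Type*} (G : SimpleGraph V) where
  /-- the successor of a dart in the cyclic order around its initial vertex -/
  next : Equiv.Perm G.Dart
  fst_next : ∀ d : G.Dart, (next d).fst = d.fst
  sameCycle_of_fst_eq : ∀ d e : G.Dart, d.fst = e.fst → next.SameCycle d e

namespace RotationSystem

variable {V : Type*} {G : SimpleGraph V}

/-- The permutation of the darts that walks along face boundaries: traverse a dart, then continue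
with the successor, at its end vertex, of the reversed dart. -/
def facePerm (R : RotationSystem G) : Equiv.Perm G.Dart :=
  (SimpleGraph.Dart.symm_involutive (G := G)).toPerm.trans R.next

/-- The facial walks having at least one edge: the cycles of `facePerm`. -/
def FacialWalk (R : RotationSystem G) : Type _ :=
  Quotient (Equiv.Perm.SameCycle.setoid R.facePerm)

/-- The number of discs glued to the graph in order to obtain closed surfaces, one surface for each
connected component: one disc for each facial walk with an edge, and one disc for each isolated
vertex, whose facial walk has length zero. -/
noncomputable def numFaces (R : RotationSystem G) : ℕ :=
  Nat.card R.FacialWalk + Nat.card {v : V // ∀ w, ¬ G.Adj v w}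

/-- The Euler characteristic of the disjoint union of the closed surfaces obtained from the
components of the graph by gluing a disc along every facial walk. -/
noncomputable def eulerChar (R : RotationSystem G) : ℤ :=
  (Nat.card V : ℤ) - (Nat.card G.edgeSet : ℤ) + (R.numFaces : ℤ)

/-- The rotation system is that of a drawing of `G` in the plane: every component is embedded in a
sphere. A component that is embedded in an orientable surface of genus `g` contributes `2 - 2 * g`
to the Euler characteristic, so all genera vanish if and only if the total is twice the number of
connected components. -/
def IsPlanar (R : RotationSystem G) : Prop :=
  R.eulerChar = 2 * (Nat.card G.ConnectedComponent : ℤ)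

end RotationSystem

/-- A finite plane graph, given by its underlying simple graph `G` and by the cyclic order, in the
drawing, of the edges around each vertex (a combinatorial map of genus zero). -/
structure PlaneEmbedding {V : Type*} [Finite V] (G : SimpleGraph V) extends RotationSystem G where
  isPlanar : toRotationSystem.IsPlanar

section Stars

variable {V : Type*} [Fintype V] (G : SimpleGraph V) [DecidableRel G.Adj]

/-- A star in `G`: a center together with some of its neighbours, the ends of the rays. -/
structure StarIn where
  center : V
  leaves : Finset V
  adj : ∀ u ∈ leaves, G.Adj center u

variable {G}

/-- A `k`-star has `k` rays. -/
def StarIn.IsKStar (S : StarIn G) (k : ℕ) : Prop := S.leaves.card = k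

/-- A star is minor if its center has degree at most five in the whole graph. -/
def StarIn.IsMinor (S : StarIn G) : Prop := G.degree S.center ≤ 5

/-- The weight of a star: the sum of the degrees in `G` of its vertices. -/
def StarIn.weight (S : StarIn G) : ℕ := G.degree S.center + ∑ u ∈ S.leaves, G.degree u

/-- The height of a star: the maximum degree in `G` of its vertices. -/
def StarIn.height (S : StarIn G) : ℕ :=
  max (G.degree S.center) (S.leaves.sup fun u => G.degree u)

/-- The plane graph contains a `⟨κ 0, κ 1, κ 2, κ 3, κ 4⟩`-star: a vertex of degree five whose
neighbours, listed in cyclic order (clockwise or counterclockwise, from some starting point), have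
degrees at most `κ 0, …, κ 4`. An entry `⊤` is no restriction. -/
def PlaneEmbedding.HasCyclicStar (P : PlaneEmbedding G) (κ : Fin 5 → ℕ∞) : Prop :=
  ∃ d : G.Dart, G.degree d.fst = 5 ∧
    ((∀ i : Fin 5, (G.degree ((P.next ^ (i : ℕ)) d).snd : ℕ∞) ≤ κ i) ∨
      (∀ i : Fin 5, (G.degree ((P.next⁻¹ ^ (i : ℕ)) d).snd : ℕ∞) ≤ κ i))

end Stars

end PlaneStar

/-! ### Discharging rules and their numerical verification -/

namespace PlaneStar

/-! The proof is by discharging. Suppose that no light and low star exists. Give each vertex `v` the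
charge `deg v - 6`, and a further 1/2 for each of its corners in a non-triangular face. A face of
length `ℓ ≥ 4` satisfies `2ℓ - 6 ≥ ℓ / 2`, so Euler's formula makes the total negative
(`PlaneEmbedding.sum_charge_neg`). Charge is then moved along darts by `transfer`, which preserves
the total; the contradiction is that every vertex ends nonnegative. In units of 1/168, a 5-vertex
starts at -168 and a non-triangular corner is worth 84.

A vertex of degree at least 6, other than 7, splits its charge evenly over its edges. The portion of
a neighbour of degree at least 6 goes in halves to the two neighbours beside it in the rotation, as
far as these have degree 5. Degree 7 follows the finer table `sevenGift`. For some neighbourhoods of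
a 5-vertex the certain income is still too small, essentially `(z,5,5,q,5)` with `z` large and `7 ≤
q ≤ 9`, and `(z,5,6,7,5)` with `z ≥ 24`. There either a 5-neighbour helps through `aid`, or the
7-vertex pays 6 more (`help_le_transfer`).

A 5-vertex never sends more than 84 (`outlays_le`). As there is no light and low star, the degrees
of its neighbours sum to at least 41, or one of them is at least 18. With two non-triangular corners
a linear bound on the income suffices. With one or none, a finite search over degree classes shows
that only the excluded stars could fail. Classes suffice because `degClass` preserves the thresholds
5, 6, 7, 17 and 23, and is exact up to 17, the only range where the sum matters. -/

/-- Degrees, rounded down to the values that the discharging rules distinguish. -/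
def degClass (d : ℕ) : ℕ := if 24 ≤ d then 24 else if 18 ≤ d then 18 else d

/-- The values of `degClass` on degrees that are at least five. -/
def degClasses : List ℕ := [5, 6, 7, 8, 9, 10, 11, 12, 13, 14, 15, 16, 17, 18, 24]

/-- A lower bound, in units of `1 / 84`, for `(d - 6) / d`. -/
def share (d : ℕ) : ℕ := if 24 ≤ d then 63 else if 18 ≤ d then 56 else 84 * (d - 6) / d

/-- What a 7-vertex sends to a 5-neighbour, given the degrees of the three neighbours before and the
three neighbours after that one. -/
def sevenGift (l₃ l₂ l₁ r₁ r₂ r₃ : ℕ) : ℕ :=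
  if 6 ≤ l₁ ∧ 6 ≤ r₁ then 42
  else if (l₁ = 6 ∧ r₁ = 5 ∧ r₂ = 6) ∨ (r₁ = 6 ∧ l₁ = 5 ∧ l₂ = 6) then 42
  else if 6 ≤ l₁ ∨ 6 ≤ r₁ then 36
  else if l₂ = 6 ∧ r₂ = 6 ∧ l₃ = 5 ∧ r₃ = 5 then 12
  else 24

/-- What a 5-vertex is certain to receive from a neighbour of degree `d`, where `l` and `r` say
whether the neighbours next to it are known to be adjacent to it and of degree at least six. -/
def income (d : ℕ) (l r : Bool) : ℕ :=
  if d = 7 then if l && r then 42 else if l || r then 36 else 12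
  else share d * (2 + l.toNat + r.toNat)

/-- What a 5-vertex sends to a 5-neighbour on account of one of the two directions of rotation: `a`
is the degree of the neighbour before, `c` and `c'` are the degrees of the next two neighbours after
it, and `nt` says that the corner between the latter two is not triangular. -/
def aid (a c c' : ℕ) (nt : Bool) : ℕ :=
  (if 17 ≤ a ∧ c = 5 ∧ (17 ≤ c' ∨ nt) then if 24 ≤ a then 36 else 14 else 0) +
  (if c = 5 ∧ 7 ≤ a ∧ a ≤ 9 ∧ c' ≤ 16 then if a = 7 then 36 else 14 else 0) +
  (if 24 ≤ a ∧ c = 7 ∧ (c' ≠ 6 ∨ nt) then 6 else 0)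

/-- What a 5-vertex sends to a neighbour of degree `a₀`, where the other neighbours have degrees
`a₁, …, a₄` and `m`, `n` tell whether the corners between `a₁, a₂` and between `a₃, a₄` are not
triangular. -/
def outlay (a₀ a₁ a₂ a₃ a₄ : ℕ) (m n : Bool) : ℕ :=
  if a₀ = 5 then aid a₁ a₄ a₃ n + aid a₄ a₁ a₂ m else 0

/-- The total that a 5-vertex sends; `nᵢ` tells whether the corner after `aᵢ` is not triangular. -/
def outlays (a₀ a₁ a₂ a₃ a₄ : ℕ) (n₀ n₁ n₂ n₃ n₄ : Bool) : ℕ :=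
  outlay a₀ a₁ a₂ a₃ a₄ n₁ n₃ + outlay a₁ a₂ a₃ a₄ a₀ n₂ n₄ + outlay a₂ a₃ a₄ a₀ a₁ n₃ n₀ +
    outlay a₃ a₄ a₀ a₁ a₂ n₄ n₁ + outlay a₄ a₀ a₁ a₂ a₃ n₀ n₂

/-- The certain income of a 5-vertex from its neighbours of degree at least seven. -/
def incomes (a₀ a₁ a₂ a₃ a₄ : ℕ) (n₀ n₁ n₂ n₃ n₄ : Bool) : ℕ :=
  income a₀ (!n₄ && Nat.ble 6 a₄) (!n₀ && Nat.ble 6 a₁) +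
  income a₁ (!n₀ && Nat.ble 6 a₀) (!n₁ && Nat.ble 6 a₂) +
  income a₂ (!n₁ && Nat.ble 6 a₁) (!n₂ && Nat.ble 6 a₃) +
  income a₃ (!n₂ && Nat.ble 6 a₂) (!n₃ && Nat.ble 6 a₄) +
  income a₄ (!n₃ && Nat.ble 6 a₃) (!n₄ && Nat.ble 6 a₀)

/-- The help from 5-neighbours, in one direction of rotation, to a 5-vertex without nontriangular
corners. -/
def helpDir (z x p q y : ℕ) : ℕ :=
  if x = 5 ∧ y = 5 then
    if p = 5 ∧ 17 ≤ z ∧ 7 ≤ q ∧ q ≤ 9 then if q = 7 then 36 else 14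
    else if p = 6 ∧ q = 7 ∧ 24 ≤ z then 6 else 0
  else 0

theorem sevenGift_ge (l₃ l₂ l₁ r₁ r₂ r₃ : ℕ) (l r : Bool) (hl : l → 6 ≤ l₁) (hr : r → 6 ≤ r₁) :
    income 7 l r ≤ sevenGift l₃ l₂ l₁ r₁ r₂ r₃ := by
  unfold income sevenGift
  cases l <;> cases r <;> simp at hl hr ⊢ <;> split_ifs <;> omega

theorem sevenGift_comm (l₃ l₂ l₁ r₁ r₂ r₃ : ℕ) :
    sevenGift l₃ l₂ l₁ r₁ r₂ r₃ = sevenGift r₃ r₂ r₁ l₁ l₂ l₃ := by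
  unfold sevenGift
  split_ifs <;> first | rfl | omega

/-- The constants are the exact values of `84 * (d - 6) / d` at the lower ends of the classes, 56 at
18 and 63 at 24; the quotient increases with `d`. -/
theorem share_mul_le {d : ℕ} (hd : 6 ≤ d) : share d * d ≤ 84 * (d - 6) := by
  unfold share
  split_ifs with h₁ h₂
  · omega
  · omega
  · exact Nat.div_mul_le_self _ _

theorem share_degClass (d : ℕ) : share (degClass d) = share d := by
  unfold share degClass
  split_ifs <;> first | rfl | omega

theorem degClass_mem {d : ℕ} (hd : 5 ≤ d) : degClass d ∈ degClasses := by
  unfold degClass degClasses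
  split_ifs with h₁ h₂
  · simp
  · simp
  · interval_cases d <;> simp

theorem income_mono (d : ℕ) {l r l' r' : Bool} (hl : l ≤ l') (hr : r ≤ r') :
    income d l r ≤ income d l' r' := by
  unfold income
  by_cases h : d = 7
  · simp only [h, if_true]
    revert hl hr
    cases l <;> cases r <;> cases l' <;> cases r' <;> decide
  · simp only [h, if_false]
    refine Nat.mul_le_mul_left _ ?_
    revert hl hr
    cases l <;> cases r <;> cases l' <;> cases r' <;> decide

theorem aid_le (a c c' : ℕ) (nt : Bool) :
    aid a c c' nt ≤ if c = 5 then (if 6 ≤ a then 36 else 0) else (if 6 ≤ a ∧ 6 ≤ c then 6 else 0) := by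
  unfold aid
  cases nt <;> simp <;> split_ifs <;> omega

theorem outlay_le (a₀ a₁ a₂ a₃ a₄ : ℕ) (m n : Bool) :
    outlay a₀ a₁ a₂ a₃ a₄ m n ≤ if a₀ = 5 then
      (if a₁ = 5 then (if a₄ = 5 then 0 else 36) else (if a₄ = 5 then 36 else 6)) else 0 := by
  have h₁ := aid_le a₁ a₄ a₃ n
  have h₂ := aid_le a₄ a₁ a₂ m
  unfold outlay
  -- Between two neighbours of degree at least 6 only the last term of `aid` survives, and it cannot
  -- occur in both directions.
  have h : 24 ≤ a₁ ∧ a₄ = 7 → ¬ (24 ≤ a₄ ∧ a₁ = 7) := by omega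
  split_ifs with h₀ h₃ h₄ h₄
  · simp [h₃, h₄] at *; omega
  · simp [h₃, h₄] at *; split_ifs at * <;> omega
  · simp [h₃, h₄] at *; split_ifs at * <;> omega
  · unfold aid; simp only [h₃, h₄]; simp; split_ifs <;> omega
  · exact le_rfl

/-- Split the 5-neighbours into cyclic runs. A run of length one costs at most 6; a longer one costs
at most 36 at each end and nothing inside. Five places have no room for two long runs, so the total
is in fact at most 72 + 6. -/
theorem outlays_le (a₀ a₁ a₂ a₃ a₄ : ℕ) (n₀ n₁ n₂ n₃ n₄ : Bool) :
    outlays a₀ a₁ a₂ a₃ a₄ n₀ n₁ n₂ n₃ n₄ ≤ 84 := by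
  have h₀ := outlay_le a₀ a₁ a₂ a₃ a₄ n₁ n₃
  have h₁ := outlay_le a₁ a₂ a₃ a₄ a₀ n₂ n₄
  have h₂ := outlay_le a₂ a₃ a₄ a₀ a₁ n₃ n₀
  have h₃ := outlay_le a₃ a₄ a₀ a₁ a₂ n₄ n₁
  have h₄ := outlay_le a₄ a₀ a₁ a₂ a₃ n₀ n₂
  unfold outlays
  generalize outlay a₀ a₁ a₂ a₃ a₄ n₁ n₃ = x₀ at *
  generalize outlay a₁ a₂ a₃ a₄ a₀ n₂ n₄ = x₁ at *
  generalize outlay a₂ a₃ a₄ a₀ a₁ n₃ n₀ = x₂ at *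
  generalize outlay a₃ a₄ a₀ a₁ a₂ n₄ n₁ = x₃ at *
  generalize outlay a₄ a₀ a₁ a₂ a₃ n₀ n₂ = x₄ at *
  by_cases e₀ : a₀ = 5 <;> by_cases e₁ : a₁ = 5 <;> by_cases e₂ : a₂ = 5 <;>
    by_cases e₃ : a₃ = 5 <;> by_cases e₄ : a₄ = 5 <;>
    simp only [e₀, e₁, e₂, e₃, e₄, if_true, if_false] at h₀ h₁ h₂ h₃ h₄ <;> omega

/-- A lower bound for the income from the first two of five neighbours in cyclic order, if the
corner between them is triangular. -/
def incomeTwo (a b : ℕ) : ℕ := income a false (Nat.ble 6 b) + income b (Nat.ble 6 a) false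

/-- The same for the first three neighbours. -/
def incomeThree (a b c : ℕ) : ℕ :=
  income a false (Nat.ble 6 b) + income b (Nat.ble 6 a) (Nat.ble 6 c) +
    income c (Nat.ble 6 b) false

/-- The same for the first four neighbours. -/
def incomeFour (a b c d : ℕ) : ℕ :=
  income a false (Nat.ble 6 b) + income b (Nat.ble 6 a) (Nat.ble 6 c) +
    income c (Nat.ble 6 b) (Nat.ble 6 d) + income d (Nat.ble 6 c) false

/-- The same for all five neighbours, if the last corner need not be triangular. -/
def incomeFive (a b c d e : ℕ) : ℕ :=
  income a false (Nat.ble 6 b) + income b (Nat.ble 6 a) (Nat.ble 6 c) +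
    income c (Nat.ble 6 b) (Nat.ble 6 d) + income d (Nat.ble 6 c) (Nat.ble 6 e) +
    income e (Nat.ble 6 d) false

/-- Look for a cyclic sequence of degree classes that violates `P`, up to sequences for which the
income alone is at least `t`; only entries allowed by `ok`, given the first one, are considered. -/
def searchStars (t : ℕ) (ok : ℕ → ℕ → Bool) (P : ℕ → ℕ → ℕ → ℕ → ℕ → Bool) : Bool :=
  degClasses.all fun a => degClasses.all fun b => !ok a b || (Nat.ble t (incomeTwo a b) ||
    degClasses.all fun c => !ok a c || (Nat.ble t (incomeThree a b c) ||
      degClasses.all fun d => !ok a d || (Nat.ble t (incomeFour a b c d) ||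
        degClasses.all fun e => !ok a e || (Nat.ble t (incomeFive a b c d e) || P a b c d e))))

/-- Ignoring the last corner gives a lower bound whether or not it is triangular, so both searches
can prune with it. -/
theorem incomeFive_le_incomes (a b c d e : ℕ) (n : Bool) :
    incomeFive a b c d e ≤ incomes a b c d e false false false false n := by
  unfold incomeFive incomes
  simp only [Bool.not_false, Bool.true_and]
  gcongr
  · exact income_mono _ (Bool.false_le _) le_rfl
  · exact income_mono _ le_rfl (Bool.false_le _)

theorem incomeFour_le_incomeFive (a b c d e : ℕ) : incomeFour a b c d ≤ incomeFive a b c d e := by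
  unfold incomeFive incomeFour
  have := income_mono d (le_refl (Nat.ble 6 c)) (Bool.false_le (Nat.ble 6 e))
  omega

theorem incomeThree_le_incomeFour (a b c d : ℕ) : incomeThree a b c ≤ incomeFour a b c d := by
  unfold incomeFour incomeThree
  have := income_mono c (le_refl (Nat.ble 6 b)) (Bool.false_le (Nat.ble 6 d))
  omega

theorem incomeTwo_le_incomeThree (a b c : ℕ) : incomeTwo a b ≤ incomeThree a b c := by
  unfold incomeThree incomeTwo
  have := income_mono b (le_refl (Nat.ble 6 a)) (Bool.false_le (Nat.ble 6 c))
  omega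

/-- The partial incomes increase as neighbours are added, so a branch cut off at `t` also has full
income at least `t`. -/
theorem searchStars_sound {t : ℕ} {ok : ℕ → ℕ → Bool} {P : ℕ → ℕ → ℕ → ℕ → ℕ → Bool}
    (h : searchStars t ok P = true) {a b c d e : ℕ} (ha : a ∈ degClasses) (hb : b ∈ degClasses)
    (hc : c ∈ degClasses) (hd : d ∈ degClasses) (he : e ∈ degClasses) (hab : ok a b = true)
    (hac : ok a c = true) (had : ok a d = true) (hae : ok a e = true) :
    t ≤ incomeFive a b c d e ∨ P a b c d e = true := by
  have h₂ := incomeTwo_le_incomeThree a b c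
  have h₃ := incomeThree_le_incomeFour a b c d
  have h₄ := incomeFour_le_incomeFive a b c d e
  simp only [searchStars, List.all_eq_true, Bool.or_eq_true, Nat.ble_eq] at h
  rcases h a ha b hb with h | h | h
  · simp [hab] at h
  · omega
  rcases h c hc with h | h | h
  · simp [hac] at h
  · omega
  rcases h d hd with h | h | h
  · simp [had] at h
  · omega
  rcases h e he with h | h | h
  · simp [hae] at h
  · omega
  · exact Or.inr h

/-- The final charge of a 5-vertex without nontriangular corners is nonnegative, unless it is the
center of a light and low star or of one of the excluded stars; `a` is the largest degree. -/
def triangularCheck (a b c d e : ℕ) : Bool :=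
  (Nat.blt (a + b + c + d + e) 41 && Nat.blt a 18) ||
  (Nat.ble b 5 && Nat.ble e 5 && ((Nat.ble c 6 && Nat.ble d 6) ||
    (Nat.ble a 23 && ((Nat.ble c 6 && Nat.ble d 7) || (Nat.ble c 7 && Nat.ble d 6))))) ||
  Nat.ble (168 + outlays a b c d e false false false false false)
    (incomes a b c d e false false false false false + (helpDir a b c d e + helpDir a e d c b))

/-- The same for a 5-vertex whose only nontriangular corner is the last one. -/
def nontriangularCheck (a b c d e : ℕ) : Bool :=
  (Nat.blt (a + b + c + d + e) 41 && Nat.blt a 18 && Nat.blt b 18 && Nat.blt c 18 &&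
    Nat.blt d 18 && Nat.blt e 18) ||
  (Nat.ble a 5 && Nat.ble b 5 && Nat.ble d 5 && Nat.ble e 5) ||
  Nat.ble (84 + outlays a b c d e false false false false true)
    (incomes a b c d e false false false false true)

/-- The cutoff is 252 = 168 + 84, the deficit plus the largest possible outlay. The largest class
may come first by rotation, which shortens the search. -/
theorem searchStars_triangularCheck :
    searchStars 252 (fun a b => Nat.ble b a) triangularCheck = true := by
  decide +kernel

/-- Here the corner has paid 84 of the deficit, so the cutoff is 84 + 84. The bad corner fixes the
starting point, hence no ordering is imposed. -/
theorem searchStars_nontriangularCheck :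
    searchStars 168 (fun _ _ => true) nontriangularCheck = true := by
  decide +kernel

theorem outlays_le_incomes_of_triangular {a b c d e : ℕ} (ha : a ∈ degClasses)
    (hb : b ∈ degClasses) (hc : c ∈ degClasses) (hd : d ∈ degClasses) (he : e ∈ degClasses)
    (hab : b ≤ a) (hac : c ≤ a) (had : d ≤ a) (hae : e ≤ a)
    (hlight : 41 ≤ a + b + c + d + e ∨ 18 ≤ a)
    (h₁ : ¬ (b ≤ 5 ∧ c ≤ 6 ∧ d ≤ 6 ∧ e ≤ 5))
    (h₂ : ¬ (a ≤ 23 ∧ b ≤ 5 ∧ c ≤ 6 ∧ d ≤ 7 ∧ e ≤ 5))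
    (h₃ : ¬ (a ≤ 23 ∧ b ≤ 5 ∧ c ≤ 7 ∧ d ≤ 6 ∧ e ≤ 5)) :
    168 + outlays a b c d e false false false false false ≤
      incomes a b c d e false false false false false + (helpDir a b c d e + helpDir a e d c b) := by
  rcases searchStars_sound searchStars_triangularCheck ha hb hc hd he (Nat.ble_eq.mpr hab)
    (Nat.ble_eq.mpr hac) (Nat.ble_eq.mpr had) (Nat.ble_eq.mpr hae) with h | h
  · have h₄ := outlays_le a b c d e false false false false false
    have h₅ := incomeFive_le_incomes a b c d e false
    omega
  · simp only [triangularCheck, Bool.or_eq_true, Bool.and_eq_true, Nat.ble_eq, Nat.blt_eq] at h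
    omega

theorem outlays_le_incomes_of_nontriangular {a b c d e : ℕ} (ha : a ∈ degClasses)
    (hb : b ∈ degClasses) (hc : c ∈ degClasses) (hd : d ∈ degClasses) (he : e ∈ degClasses)
    (hlight : 41 ≤ a + b + c + d + e ∨ 18 ≤ a ∨ 18 ≤ b ∨ 18 ≤ c ∨ 18 ≤ d ∨ 18 ≤ e)
    (h₁ : ¬ (a ≤ 5 ∧ b ≤ 5 ∧ d ≤ 5 ∧ e ≤ 5)) :
    84 + outlays a b c d e false false false false true ≤
      incomes a b c d e false false false false true := by
  rcases searchStars_sound searchStars_nontriangularCheck ha hb hc hd he rfl rfl rfl rfl with h | h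
  · have h₄ := outlays_le a b c d e false false false false true
    have h₅ := incomeFive_le_incomes a b c d e true
    omega
  · simp only [nontriangularCheck, Bool.or_eq_true, Bool.and_eq_true, Nat.ble_eq, Nat.blt_eq] at h
    omega

/-- A linear minorant of the income: summed over five neighbours of total degree at least 41 it
yields 9 · 41 - 5 · 54 = 99, more than the maximal outlay 84. -/
theorem le_income_of_le {d : ℕ} (hd : d ∈ degClasses) (l r : Bool) (hd' : d ≤ 17) :
    9 * d ≤ income d l r + 54 := by
  have h' : 9 * d ≤ income d false false + 54 := by
    clear l r; revert hd' d; decide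
  have h := income_mono d (Bool.false_le l) (Bool.false_le r)
  omega

theorem le_income_of_ge {d : ℕ} (hd : d ∈ degClasses) (l r : Bool) (hd' : 18 ≤ d) :
    112 ≤ income d l r := by
  have h' : 112 ≤ income d false false := by
    clear l r; revert hd' d; decide
  have h := income_mono d (Bool.false_le l) (Bool.false_le r)
  omega

theorem outlays_le_incomes_of_two_nontriangular {a b c d e : ℕ} (ha : a ∈ degClasses)
    (hb : b ∈ degClasses) (hc : c ∈ degClasses) (hd : d ∈ degClasses) (he : e ∈ degClasses)
    (hlight : 41 ≤ a + b + c + d + e ∨ 18 ≤ a ∨ 18 ≤ b ∨ 18 ≤ c ∨ 18 ≤ d ∨ 18 ≤ e)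
    (n₀ n₁ n₂ n₃ n₄ : Bool) :
    outlays a b c d e n₀ n₁ n₂ n₃ n₄ ≤ incomes a b c d e n₀ n₁ n₂ n₃ n₄ := by
  refine (outlays_le a b c d e n₀ n₁ n₂ n₃ n₄).trans ?_
  unfold incomes
  have ka := le_income_of_le ha (!n₄ && Nat.ble 6 e) (!n₀ && Nat.ble 6 b)
  have kb := le_income_of_le hb (!n₀ && Nat.ble 6 a) (!n₁ && Nat.ble 6 c)
  have kc := le_income_of_le hc (!n₁ && Nat.ble 6 b) (!n₂ && Nat.ble 6 d)
  have kd := le_income_of_le hd (!n₂ && Nat.ble 6 c) (!n₃ && Nat.ble 6 e)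
  have ke := le_income_of_le he (!n₃ && Nat.ble 6 d) (!n₄ && Nat.ble 6 a)
  have ka' := le_income_of_ge ha (!n₄ && Nat.ble 6 e) (!n₀ && Nat.ble 6 b)
  have kb' := le_income_of_ge hb (!n₀ && Nat.ble 6 a) (!n₁ && Nat.ble 6 c)
  have kc' := le_income_of_ge hc (!n₁ && Nat.ble 6 b) (!n₂ && Nat.ble 6 d)
  have kd' := le_income_of_ge hd (!n₂ && Nat.ble 6 c) (!n₃ && Nat.ble 6 e)
  have ke' := le_income_of_ge he (!n₃ && Nat.ble 6 d) (!n₄ && Nat.ble 6 a)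
  omega

/-- What a 7-vertex sends altogether, given the degrees of its neighbours in cyclic order. -/
def sevenGifts (a b c d e f g : ℕ) : ℕ :=
  (if a = 5 then sevenGift d c b g f e else 0) + (if b = 5 then sevenGift e d c a g f else 0) +
  (if c = 5 then sevenGift f e d b a g else 0) + (if d = 5 then sevenGift g f e c b a else 0) +
  (if e = 5 then sevenGift a g f d c b else 0) + (if f = 5 then sevenGift b a g e d c else 0) +
  (if g = 5 then sevenGift c b a f e d else 0)

/-- The budget is the whole charge 168 of a 7-vertex; seven 5-neighbours at 24 each exhaust it. -/
theorem sevenGifts_check : ∀ a ∈ [5, 6, 7], ∀ b ∈ [5, 6, 7], ∀ c ∈ [5, 6, 7], ∀ d ∈ [5, 6, 7],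
    ∀ e ∈ [5, 6, 7], ∀ f ∈ [5, 6, 7], ∀ g ∈ [5, 6, 7], sevenGifts a b c d e f g ≤ 168 := by
  decide +kernel

/-- Degrees are only compared with 5 and 6, so all values from 7 on are alike and `3 ^ 7`
neighbourhoods remain. -/
theorem sevenGift_min (a b c d e f : ℕ) :
    sevenGift (min a 7) (min b 7) (min c 7) (min d 7) (min e 7) (min f 7) =
      sevenGift a b c d e f := by
  have h₆ (x : ℕ) : 6 ≤ min x 7 ↔ 6 ≤ x := by omega
  have e₆ (x : ℕ) : min x 7 = 6 ↔ x = 6 := by omega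
  have e₅ (x : ℕ) : min x 7 = 5 ↔ x = 5 := by omega
  simp only [sevenGift, h₆, e₆, e₅]

theorem sevenGifts_le {a b c d e f g : ℕ} (ha : 5 ≤ a) (hb : 5 ≤ b) (hc : 5 ≤ c) (hd : 5 ≤ d)
    (he : 5 ≤ e) (hf : 5 ≤ f) (hg : 5 ≤ g) : sevenGifts a b c d e f g ≤ 168 := by
  have hm {x : ℕ} (hx : 5 ≤ x) : min x 7 ∈ [5, 6, 7] := by
    simp only [List.mem_cons, List.not_mem_nil, or_false]; omega
  have e₅ (x : ℕ) : min x 7 = 5 ↔ x = 5 := by omega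
  have h := sevenGifts_check _ (hm ha) _ (hm hb) _ (hm hc) _ (hm hd) _ (hm he) _ (hm hf) _ (hm hg)
  simpa only [sevenGifts, sevenGift_min, e₅] using h

/-! ### Triangular corners, mirror images and the transfers -/

namespace RotationSystem

section Rules

variable {V : Type*} {G : SimpleGraph V}

theorem next_inv (R : RotationSystem G) (d : G.Dart) : R.next (R.next⁻¹ d) = d :=
  R.next.apply_symm_apply d

theorem inv_next (R : RotationSystem G) (d : G.Dart) : R.next⁻¹ (R.next d) = d :=
  R.next.symm_apply_apply d

/-- The rotation system of the mirror image. -/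
def mirror (R : RotationSystem G) : RotationSystem G where
  next := R.next⁻¹
  fst_next d := by
    have h := R.fst_next (R.next⁻¹ d)
    rw [next_inv] at h
    exact h.symm
  sameCycle_of_fst_eq d e h := Equiv.Perm.sameCycle_inv.mpr (R.sameCycle_of_fst_eq d e h)

/-- The corner between a dart and the next one belongs to a triangular face. -/
def IsTri (R : RotationSystem G) (d : G.Dart) : Prop :=
  R.next (R.next (R.next d).symm).symm = d.symm

open Classical in
/-- The corner between a dart and the next one belongs to a face that is not a triangle. -/
noncomputable def nonTri (R : RotationSystem G) (d : G.Dart) : Bool := decide (¬ R.IsTri d)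

theorem nonTri_eq_false {R : RotationSystem G} {d : G.Dart} : R.nonTri d = false ↔ R.IsTri d := by
  simp [nonTri]

theorem mirror_isTri (R : RotationSystem G) (d : G.Dart) :
    R.mirror.IsTri d ↔ R.IsTri (R.next⁻¹ d) := by
  simp only [IsTri, mirror, next_inv]
  constructor
  · intro h
    have h' := congrArg R.next h
    rw [next_inv] at h'
    rw [← h']
    simp
  · intro h
    have h' := congrArg (R.next⁻¹ : Equiv.Perm G.Dart) h
    rw [inv_next] at h'
    rw [← h']
    simp [inv_next]

theorem mirror_nonTri (R : RotationSystem G) (d : G.Dart) :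
    R.mirror.nonTri d = R.nonTri (R.next⁻¹ d) := by
  unfold nonTri
  exact decide_eq_decide.mpr (not_congr (R.mirror_isTri d))

theorem mirror_next (R : RotationSystem G) : R.mirror.next = R.next⁻¹ := rfl

/-- Both sides are the third edge of the triangle, which links the rotations at the two outer
vertices. Thus degrees around a neighbour can be read off from the degrees around the center. -/
theorem IsTri.next_symm {R : RotationSystem G} {d : G.Dart} (h : R.IsTri d) :
    R.next (R.next d).symm = (R.next⁻¹ d.symm).symm := by
  rw [← h]
  simp

theorem fst_inv_next (R : RotationSystem G) (d : G.Dart) : (R.next⁻¹ d).fst = d.fst :=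
  R.mirror.fst_next d

variable [Fintype V] [DecidableRel G.Adj]

/-- The class of the degree of the end vertex of a dart. -/
def sndClass (d : G.Dart) : ℕ := degClass (G.degree d.snd)

theorem degree_congr {v w : V} (h : v = w) : G.degree v = G.degree w := by subst h; rfl

theorem sndClass_congr {d e : G.Dart} (h : d.snd = e.snd) : sndClass d = sndClass e :=
  congrArg degClass (degree_congr h)

theorem IsTri.sndClass_next {R : RotationSystem G} {d : G.Dart} (h : R.IsTri d) :
    sndClass (R.next (R.next d).symm) = sndClass d := by
  rw [h.next_symm]
  exact sndClass_congr (R.fst_inv_next _)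

theorem IsTri.sndClass_inv_next {R : RotationSystem G} {d : G.Dart} (h : R.IsTri d) :
    sndClass (R.next⁻¹ d.symm) = sndClass (R.next d) := by
  have h' : R.next⁻¹ d.symm = (R.next (R.next d).symm).symm := by rw [h.next_symm]; simp
  rw [h']
  exact sndClass_congr (R.fst_next _)

/-- The charge, in units of `1 / 168`, that the first vertex of a dart sends to the second one. -/
noncomputable def transfer (R : RotationSystem G) (e : G.Dart) : ℕ :=
  if G.degree e.snd = 5 then
    if G.degree e.fst = 5 then
      aid (sndClass (R.next e)) (sndClass (R.next⁻¹ e)) (sndClass (R.next⁻¹ (R.next⁻¹ e)))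
        (R.nonTri (R.next⁻¹ (R.next⁻¹ e))) +
      aid (sndClass (R.next⁻¹ e)) (sndClass (R.next e)) (sndClass (R.next (R.next e)))
        (R.nonTri (R.next e))
    else if G.degree e.fst = 7 then
      sevenGift (sndClass (R.next (R.next (R.next e)))) (sndClass (R.next (R.next e)))
        (sndClass (R.next e)) (sndClass (R.next⁻¹ e)) (sndClass (R.next⁻¹ (R.next⁻¹ e)))
        (sndClass (R.next⁻¹ (R.next⁻¹ (R.next⁻¹ e))))
    else share (G.degree e.fst) * (2 + (Nat.ble 6 (sndClass (R.next e))).toNat +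
      (Nat.ble 6 (sndClass (R.next⁻¹ e))).toNat)
  else 0

theorem mirror_transfer (R : RotationSystem G) (e : G.Dart) :
    R.mirror.transfer e = R.transfer e := by
  simp only [transfer, mirror_nonTri, mirror_next, inv_inv, inv_next]
  split_ifs
  · rw [add_comm]
  · rw [sevenGift_comm]
  · ring
  · rfl

theorem degClass_eq_five {d : ℕ} : degClass d = 5 ↔ d = 5 := by
  unfold degClass; split_ifs <;> omega

theorem degClass_eq_seven {d : ℕ} : degClass d = 7 ↔ d = 7 := by
  unfold degClass; split_ifs <;> omega

/-- A 5-vertex receives its certain income. -/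
theorem income_le_transfer (R : RotationSystem G) {d : G.Dart} (hd : G.degree d.fst = 5) :
    income (sndClass d) (!R.nonTri (R.next⁻¹ d) && Nat.ble 6 (sndClass (R.next⁻¹ d)))
      (!R.nonTri d && Nat.ble 6 (sndClass (R.next d))) ≤ R.transfer d.symm := by
  have hr : (!R.nonTri d && Nat.ble 6 (sndClass (R.next d))) = true →
      6 ≤ sndClass (R.next⁻¹ d.symm) := by
    intro h
    simp only [Bool.and_eq_true, Bool.not_eq_true', nonTri_eq_false, Nat.ble_eq] at h
    rw [h.1.sndClass_inv_next]; exact h.2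
  have hl : (!R.nonTri (R.next⁻¹ d) && Nat.ble 6 (sndClass (R.next⁻¹ d))) = true →
      6 ≤ sndClass (R.next d.symm) := by
    intro h
    simp only [Bool.and_eq_true, Bool.not_eq_true', nonTri_eq_false, Nat.ble_eq] at h
    have := h.1.sndClass_next
    rw [next_inv] at this
    rw [this]; exact h.2
  generalize (!R.nonTri d && Nat.ble 6 (sndClass (R.next d))) = r at *
  generalize (!R.nonTri (R.next⁻¹ d) && Nat.ble 6 (sndClass (R.next⁻¹ d))) = l at *
  unfold transfer
  have hs : G.degree d.symm.snd = 5 := hd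
  have hf : d.symm.fst = d.snd := rfl
  rw [if_pos hs, hf]
  split_ifs with h h
  · have : sndClass d = 5 := degClass_eq_five.mpr h
    rw [this]
    simp [income, share]
  · have : sndClass d = 7 := degClass_eq_seven.mpr h
    rw [this]
    exact sevenGift_ge _ _ _ _ _ _ _ _ hl hr
  · have h7 : sndClass d ≠ 7 := fun h' => h (degClass_eq_seven.mp h')
    unfold income
    rw [if_neg h7, sndClass, share_degClass]
    refine Nat.mul_le_mul_left _ ?_
    have hl' : l.toNat ≤ (Nat.ble 6 (sndClass (R.next d.symm))).toNat :=
      Bool.toNat_le_toNat fun h => Nat.ble_eq.mpr (hl h)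
    have hr' : r.toNat ≤ (Nat.ble 6 (sndClass (R.next⁻¹ d.symm))).toNat :=
      Bool.toNat_le_toNat fun h => Nat.ble_eq.mpr (hr h)
    omega

/-- A 5-vertex without nontriangular corners receives its certain income and the help in one
direction of rotation. -/
theorem help_le_transfer (R : RotationSystem G) {x₀ x₁ x₂ x₃ x₄ : G.Dart} (e₀ : R.next x₀ = x₁)
    (e₁ : R.next x₁ = x₂) (e₂ : R.next x₂ = x₃) (e₃ : R.next x₃ = x₄) (e₄ : R.next x₄ = x₀)
    (hd : G.degree x₀.fst = 5) (t₀ : R.IsTri x₀) (t₁ : R.IsTri x₁) (t₂ : R.IsTri x₂)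
    (t₃ : R.IsTri x₃) (t₄ : R.IsTri x₄)
    (hz : sndClass x₁ ≤ 5 → sndClass x₂ ≤ 6 → sndClass x₃ ≤ 7 → sndClass x₄ ≤ 5 →
      24 ≤ sndClass x₀) :
    helpDir (sndClass x₀) (sndClass x₁) (sndClass x₂) (sndClass x₃) (sndClass x₄) = 0 ∨
    (sndClass x₁ = 5 ∧ sndClass x₂ = 5 ∧
      helpDir (sndClass x₀) (sndClass x₁) (sndClass x₂) (sndClass x₃) (sndClass x₄) ≤
        R.transfer x₁.symm + R.transfer x₂.symm) ∨
    (sndClass x₃ = 7 ∧ sndClass x₄ = 5 ∧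
      helpDir (sndClass x₀) (sndClass x₁) (sndClass x₂) (sndClass x₃) (sndClass x₄) = 6 ∧
        (6 ≤ R.transfer x₄.symm ∨ 42 ≤ R.transfer x₃.symm)) := by
  have f₁ : x₁.fst = x₀.fst := by rw [← e₀, R.fst_next]
  have f₂ : x₂.fst = x₀.fst := by rw [← e₁, R.fst_next, f₁]
  have f₃ : x₃.fst = x₀.fst := by rw [← e₂, R.fst_next, f₂]
  have f₄ : x₄.fst = x₀.fst := by rw [← e₃, R.fst_next, f₃]
  have ra₁ : sndClass (R.next x₁.symm) = sndClass x₀ := by rw [← t₀.sndClass_next, e₀]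
  have rb₁ : sndClass (R.next⁻¹ x₁.symm) = sndClass x₂ := by rw [t₁.sndClass_inv_next, e₁]
  have ra₂ : sndClass (R.next x₂.symm) = sndClass x₁ := by rw [← t₁.sndClass_next, e₁]
  have rb₂ : sndClass (R.next⁻¹ x₂.symm) = sndClass x₃ := by rw [t₂.sndClass_inv_next, e₂]
  have ra₃ : sndClass (R.next x₃.symm) = sndClass x₂ := by rw [← t₂.sndClass_next, e₂]
  have rb₃ : sndClass (R.next⁻¹ x₃.symm) = sndClass x₄ := by rw [t₃.sndClass_inv_next, e₃]
  have ra₄ : sndClass (R.next x₄.symm) = sndClass x₃ := by rw [← t₃.sndClass_next, e₃]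
  have rb₄ : sndClass (R.next⁻¹ x₄.symm) = sndClass x₀ := by rw [t₄.sndClass_inv_next, e₄]
  by_cases hx : sndClass x₁ = 5 ∧ sndClass x₄ = 5
  swap
  · left; simp [helpDir, hx]
  obtain ⟨hx₁, hx₄⟩ := hx
  by_cases hA : sndClass x₂ = 5 ∧ 17 ≤ sndClass x₀ ∧ 7 ≤ sndClass x₃ ∧ sndClass x₃ ≤ 9
  · right; left
    refine ⟨hx₁, hA.1, ?_⟩
    have hT₁ : R.transfer x₁.symm ≥ aid (sndClass x₀) 5 (sndClass (R.next⁻¹ (R.next⁻¹ x₁.symm)))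
        (R.nonTri (R.next⁻¹ (R.next⁻¹ x₁.symm))) := by
      unfold transfer
      rw [if_pos (show G.degree x₁.symm.snd = 5 from (degree_congr f₁).trans hd),
        if_pos (show G.degree x₁.symm.fst = 5 from degClass_eq_five.mp hx₁), ra₁, rb₁, hA.1]
      omega
    have hT₂ : R.transfer x₂.symm ≥ aid (sndClass x₃) 5 (sndClass (R.next (R.next x₂.symm)))
        (R.nonTri (R.next x₂.symm)) := by
      unfold transfer
      rw [if_pos (show G.degree x₂.symm.snd = 5 from (degree_congr f₂).trans hd),
        if_pos (show G.degree x₂.symm.fst = 5 from degClass_eq_five.mp hA.1), ra₂, rb₂, hx₁]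
      omega
    have hh : helpDir (sndClass x₀) (sndClass x₁) (sndClass x₂) (sndClass x₃) (sndClass x₄) =
        if sndClass x₃ = 7 then 36 else 14 := by
      simp [helpDir, hx₁, hx₄, hA]
    rw [hh]
    by_cases hn : 17 ≤ sndClass (R.next⁻¹ (R.next⁻¹ x₁.symm)) ∨
        R.nonTri (R.next⁻¹ (R.next⁻¹ x₁.symm)) = true
    · have : (if sndClass x₃ = 7 then 36 else 14) ≤ aid (sndClass x₀) 5
          (sndClass (R.next⁻¹ (R.next⁻¹ x₁.symm))) (R.nonTri (R.next⁻¹ (R.next⁻¹ x₁.symm))) := by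
        unfold aid
        rw [if_pos (show 17 ≤ sndClass x₀ ∧ 5 = 5 ∧
          (17 ≤ sndClass (R.next⁻¹ (R.next⁻¹ x₁.symm)) ∨
            R.nonTri (R.next⁻¹ (R.next⁻¹ x₁.symm)) = true) from ⟨hA.2.1, rfl, hn⟩)]
        -- If the class of `x₃` is 7, then `hz` forces the class of `x₀` up to 24, where `aid` pays
        -- 36 rather than 14.
        have := hz hx₁.le (by omega)
        split_ifs <;> omega
      omega
    -- The two adjacent 5-neighbours now share a triangle on the far side of their common edge. Its
    -- apex has class at most 16, so the second one pays.
    · rw [not_or, Bool.not_eq_true, nonTri_eq_false] at hn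
      have ht := hn.2.sndClass_next
      have hs : (R.next⁻¹ x₁.symm).symm = R.next x₂.symm := by rw [← t₁.next_symm, e₁]
      rw [next_inv, hs] at ht
      have : (if sndClass x₃ = 7 then 36 else 14) ≤ aid (sndClass x₃) 5
          (sndClass (R.next (R.next x₂.symm))) (R.nonTri (R.next x₂.symm)) := by
        unfold aid
        rw [if_pos (show 5 = 5 ∧ 7 ≤ sndClass x₃ ∧ sndClass x₃ ≤ 9 ∧
          sndClass (R.next (R.next x₂.symm)) ≤ 16 from ⟨rfl, hA.2.2.1, hA.2.2.2, by omega⟩)]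
        split_ifs <;> omega
      omega
  by_cases hB : sndClass x₂ = 6 ∧ sndClass x₃ = 7 ∧ 24 ≤ sndClass x₀
  swap
  · left; simp only [helpDir, hx₁, hx₄, hA, hB]; simp
  right; right
  refine ⟨hB.2.1, hx₄, by simp [helpDir, hx₁, hx₄, hB], ?_⟩
  have hT₄ : R.transfer x₄.symm ≥ aid (sndClass x₀) 7 (sndClass (R.next (R.next x₄.symm)))
      (R.nonTri (R.next x₄.symm)) := by
    unfold transfer
    rw [if_pos (show G.degree x₄.symm.snd = 5 from (degree_congr f₄).trans hd),
      if_pos (show G.degree x₄.symm.fst = 5 from degClass_eq_five.mp hx₄), ra₄, rb₄, hB.2.1]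
    omega
  by_cases hn : sndClass (R.next (R.next x₄.symm)) ≠ 6 ∨ R.nonTri (R.next x₄.symm) = true
  · left
    have : 6 ≤ aid (sndClass x₀) 7 (sndClass (R.next (R.next x₄.symm)))
        (R.nonTri (R.next x₄.symm)) := by
      unfold aid
      rw [if_pos (show 24 ≤ sndClass x₀ ∧ 7 = 7 ∧ (sndClass (R.next (R.next x₄.symm)) ≠ 6 ∨
        R.nonTri (R.next x₄.symm) = true) from ⟨hB.2.2, rfl, hn⟩)]
      omega
    omega
  -- Around the 7-vertex the degrees run 6, 5, 5, 6, the pattern for which `sevenGift` pays 42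
  -- instead of 36.
  · right
    rw [not_or, not_not, Bool.not_eq_true, nonTri_eq_false] at hn
    have ht := hn.2.sndClass_inv_next
    have hs : (R.next x₄.symm).symm = R.next⁻¹ x₃.symm := by
      rw [← e₃, t₃.next_symm]; simp
    rw [hs, hn.1] at ht
    unfold transfer
    rw [if_pos (show G.degree x₃.symm.snd = 5 from (degree_congr f₃).trans hd),
      if_neg (show ¬ G.degree x₃.symm.fst = 5 from fun h => by
        have : sndClass x₃ = 5 := degClass_eq_five.mpr h
        omega),
      if_pos (show G.degree x₃.symm.fst = 7 from degClass_eq_seven.mp hB.2.1), ra₃, rb₃, ht,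
      hB.1, hx₄]
    simp [sevenGift]

theorem transfer_eq_outlay (R : RotationSystem G) {x₀ x₁ x₂ x₃ x₄ : G.Dart} (e₀ : R.next x₀ = x₁)
    (e₁ : R.next x₁ = x₂) (e₃ : R.next x₃ = x₄) (e₄ : R.next x₄ = x₀)
    (hd : G.degree x₀.fst = 5) :
    R.transfer x₀ = outlay (sndClass x₀) (sndClass x₁) (sndClass x₂) (sndClass x₃) (sndClass x₄)
      (R.nonTri x₁) (R.nonTri x₃) := by
  have i₀ : R.next⁻¹ x₀ = x₄ := by rw [← e₄]; simp
  have i₄ : R.next⁻¹ x₄ = x₃ := by rw [← e₃]; simp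
  unfold transfer outlay
  rw [if_pos hd, i₀, i₄, e₀, e₁]
  by_cases h : G.degree x₀.snd = 5
  · rw [if_pos h, if_pos (show sndClass x₀ = 5 from degClass_eq_five.mpr h)]
  · rw [if_neg h, if_neg (show ¬ sndClass x₀ = 5 from fun h' => h (degClass_eq_five.mp h'))]

end Rules

end RotationSystem
-- Counting darts and facial walks
namespace RotationSystem

section Faces

variable {V : Type*} {G : SimpleGraph V}

theorem facePerm_apply (R : RotationSystem G) (d : G.Dart) : R.facePerm d = R.next d.symm := rfl

theorem fst_facePerm (R : RotationSystem G) (d : G.Dart) : (R.facePerm d).fst = d.snd :=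
  R.fst_next _

/-- The facial walk that contains a dart. -/
def facialWalk (R : RotationSystem G) (d : G.Dart) : R.FacialWalk :=
  Quotient.mk (Equiv.Perm.SameCycle.setoid R.facePerm) d

theorem facialWalk_facePerm (R : RotationSystem G) (d : G.Dart) :
    R.facialWalk (R.facePerm d) = R.facialWalk d :=
  Quotient.sound (s := Equiv.Perm.SameCycle.setoid R.facePerm)
    (Equiv.Perm.sameCycle_apply_left.mpr (Equiv.Perm.SameCycle.refl _ d))

open Classical in
/-- Weights of the darts that sum up to at least twelve along every facial walk. -/
noncomputable def faceWeight (R : RotationSystem G) (d : G.Dart) : ℕ :=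
  if R.facePerm (R.facePerm (R.facePerm d)) = d then 4 else 3

theorem three_le_faceWeight (R : RotationSystem G) (d : G.Dart) : 3 ≤ R.faceWeight d := by
  unfold faceWeight; split_ifs <;> omega

/-- The facial walk through the corner after `d` enters it along `d.symm`, hence the reversal. -/
theorem faceWeight_symm_add (R : RotationSystem G) (d : G.Dart) :
    R.faceWeight d.symm + (R.nonTri d).toNat = 4 := by
  have h : R.facePerm (R.facePerm (R.facePerm d.symm)) = d.symm ↔ R.IsTri d := by
    simp only [facePerm_apply, IsTri, SimpleGraph.Dart.symm_symm]
  unfold faceWeight nonTri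
  by_cases h' : R.IsTri d
  · simp [h', h.mpr h']
  · simp [h', mt h.mp h']

theorem facePerm_ne (R : RotationSystem G) (d : G.Dart) : R.facePerm d ≠ d := by
  intro h
  have h' := R.fst_facePerm d
  rw [h] at h'
  exact d.adj.ne h'

theorem injOn_iterate_next (R : RotationSystem G) (d : G.Dart) :
    Set.InjOn (fun i => R.next^[i] d) (Finset.range (Function.minimalPeriod R.next d)) := by
  intro i hi j hj h
  simp only [Finset.coe_range, Set.mem_Iio] at hi hj
  exact (Function.iterate_eq_iterate_iff_of_lt_minimalPeriod hi hj).mp h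

end Faces

section Counting

variable {V : Type*} [Fintype V] {G : SimpleGraph V} [DecidableRel G.Adj]

open Classical in
theorem card_fst_eq (v : V) :
    (Finset.univ.filter fun e : G.Dart => e.fst = v).card = G.degree v := by
  rw [← G.dart_fst_fiber_card_eq_degree v]

open Classical in
theorem filter_fst_eq (R : RotationSystem G) (d : G.Dart) :
    (Finset.univ.filter fun e : G.Dart => e.fst = d.fst) =
      (Finset.range (Function.minimalPeriod R.next d)).image fun i => R.next^[i] d := by
  ext e
  simp only [Finset.mem_filter, Finset.mem_univ, true_and, Finset.mem_image, Finset.mem_range]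
  constructor
  · intro h
    obtain ⟨i, hi⟩ := (R.sameCycle_of_fst_eq d e h.symm).exists_nat_pow_eq
    have hp : 0 < Function.minimalPeriod R.next d :=
      Function.minimalPeriod_pos_of_mem_periodicPts
        (R.next.injective.mem_periodicPts d)
    refine ⟨i % Function.minimalPeriod R.next d, Nat.mod_lt _ hp, ?_⟩
    rw [Function.iterate_mod_minimalPeriod_eq, Equiv.Perm.iterate_eq_pow, hi]
  · rintro ⟨i, -, rfl⟩
    induction i with
    | zero => rfl
    | succ i ih => rw [Function.iterate_succ_apply', R.fst_next, ih]

theorem minimalPeriod_next (R : RotationSystem G) (d : G.Dart) :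
    Function.minimalPeriod R.next d = G.degree d.fst := by
  classical
  rw [← card_fst_eq, R.filter_fst_eq d, Finset.card_image_of_injOn (R.injOn_iterate_next d),
    Finset.card_range]

/-- Every vertex of degree `k` is encircled by `k` steps of the rotation. -/
theorem iterate_next_degree (R : RotationSystem G) (d : G.Dart) :
    R.next^[G.degree d.fst] d = d := by
  rw [← R.minimalPeriod_next d]
  exact Function.iterate_minimalPeriod

open Classical in
theorem sum_fst_eq {M : Type*} [AddCommMonoid M] (R : RotationSystem G) (d : G.Dart)
    (f : G.Dart → M) :
    ∑ e with e.fst = d.fst, f e = ∑ i ∈ Finset.range (G.degree d.fst), f (R.next^[i] d) := by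
  rw [R.filter_fst_eq d, Finset.sum_image (R.injOn_iterate_next d), R.minimalPeriod_next]

open Classical in
theorem sum_next {M : Type*} [AddCommMonoid M] (R : RotationSystem G) (v : V) (f : G.Dart → M) :
    ∑ e with e.fst = v, f (R.next e) = ∑ e with e.fst = v, f e :=
  Finset.sum_equiv R.next (by simp [R.fst_next]) (by simp)

theorem next_ne (R : RotationSystem G) (d : G.Dart) (h : 2 ≤ G.degree d.fst) : R.next d ≠ d := by
  intro h'
  have : Function.minimalPeriod R.next d = 1 := Function.minimalPeriod_eq_one_iff_isFixedPt.mpr h'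
  rw [R.minimalPeriod_next] at this
  omega

/-- A facial walk of length two turns back at an end of its edge, which would then have degree one.
-/
theorem facePerm_facePerm_ne (R : RotationSystem G) (h₂ : ∀ v, 2 ≤ G.degree v) (d : G.Dart) :
    R.facePerm (R.facePerm d) ≠ d := by
  intro h
  have h' := R.fst_facePerm (R.facePerm d)
  rw [h] at h'
  have h₃ : R.facePerm d = d.symm := by
    apply SimpleGraph.Dart.ext
    exact Prod.ext (R.fst_facePerm d) h'.symm
  exact R.next_ne d.symm (h₂ _) h₃

open Classical in
-- Walks of length one and two do not occur, so there are three darts of weight 4 or at least four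
-- darts of weight 3.
theorem twelve_le_sum_faceWeight (R : RotationSystem G) (h₂ : ∀ v, 2 ≤ G.degree v)
    (q : R.FacialWalk) :
    12 ≤ ∑ d with R.facialWalk d = q,
      R.faceWeight d := by
  obtain ⟨d, rfl⟩ : ∃ d, R.facialWalk d = q := Quotient.exists_rep q
  have hq := R.facialWalk_facePerm
  set φ := R.facePerm with hφ
  have n₁ (e : G.Dart) : φ e ≠ e := R.facePerm_ne e
  have n₂ (e : G.Dart) : φ (φ e) ≠ e := R.facePerm_facePerm_ne h₂ e
  by_cases h : φ (φ (φ d)) = d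
  · have hsub : ({d, φ d, φ (φ d)} : Finset G.Dart) ⊆ Finset.univ.filter fun e => R.facialWalk e = R.facialWalk d := by
      intro e he
      simp only [Finset.mem_insert, Finset.mem_singleton] at he
      rw [Finset.mem_filter]
      refine ⟨Finset.mem_univ _, ?_⟩
      rcases he with rfl | rfl | rfl <;> simp only [hq]
    refine le_trans ?_ (Finset.sum_le_sum_of_subset hsub)
    rw [Finset.sum_insert, Finset.sum_insert, Finset.sum_singleton]
    · have w : ∀ e, φ (φ (φ e)) = e → R.faceWeight e = 4 := fun e he => if_pos he
      rw [w d h, w (φ d) (by rw [h]), w (φ (φ d)) (by rw [h])]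
      norm_num
    · simpa using (n₁ (φ d)).symm
    · simpa using ⟨(n₁ d).symm, (n₂ d).symm⟩
  · have hsub : ({d, φ d, φ (φ d), φ (φ (φ d))} : Finset G.Dart) ⊆ Finset.univ.filter fun e => R.facialWalk e = R.facialWalk d := by
      intro e he
      simp only [Finset.mem_insert, Finset.mem_singleton] at he
      rw [Finset.mem_filter]
      refine ⟨Finset.mem_univ _, ?_⟩
      rcases he with rfl | rfl | rfl | rfl <;> simp only [hq]
    refine le_trans ?_ (Finset.sum_le_sum_of_subset hsub)
    rw [Finset.sum_insert, Finset.sum_insert, Finset.sum_insert, Finset.sum_singleton]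
    · have := R.three_le_faceWeight
      have w₀ := this d
      have w₁ := this (φ d)
      have w₂ := this (φ (φ d))
      have w₃ := this (φ (φ (φ d)))
      omega
    · simpa using (n₁ (φ (φ d))).symm
    · simpa using ⟨(n₁ d).symm, (n₂ d).symm⟩
    · simpa using ⟨(n₁ d).symm, (n₂ d).symm, Ne.symm h⟩

theorem card_facialWalk_le (R : RotationSystem G) (h₂ : ∀ v, 2 ≤ G.degree v) :
    12 * Nat.card R.FacialWalk + ∑ d : G.Dart, (R.nonTri d).toNat ≤ 4 * Fintype.card G.Dart := by
  classical
  have : Fintype R.FacialWalk := Quotient.fintype _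
  have hw : ∑ d : G.Dart, R.faceWeight d + ∑ d : G.Dart, (R.nonTri d).toNat =
      4 * Fintype.card G.Dart := by
    rw [← Equiv.sum_comp (SimpleGraph.Dart.symm_involutive (G := G)).toPerm R.faceWeight,
      ← Finset.sum_add_distrib]
    calc _ = ∑ _d : G.Dart, 4 := Finset.sum_congr rfl fun d _ => R.faceWeight_symm_add d
      _ = _ := by simp [mul_comm]
  have hf : 12 * Nat.card R.FacialWalk ≤ ∑ d : G.Dart, R.faceWeight d := by
    rw [Nat.card_eq_fintype_card, ← Finset.sum_fiberwise (s := Finset.univ)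
      (g := R.facialWalk) (f := R.faceWeight)]
    calc 12 * Fintype.card R.FacialWalk = ∑ _q : R.FacialWalk, 12 := by simp [mul_comm]
      _ ≤ _ := Finset.sum_le_sum fun q _ => R.twelve_le_sum_faceWeight h₂ q
  omega

end Counting

end RotationSystem

/-! ### Euler's formula -/

section Euler

variable {V : Type*} [Fintype V] {G : SimpleGraph V} [DecidableRel G.Adj]

/-- Euler's formula: the total charge, in units of `1 / 168`, is negative. -/
theorem PlaneEmbedding.sum_charge_neg [Nonempty V] (P : PlaneEmbedding G)
    (h₂ : ∀ v, 2 ≤ G.degree v) :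
    ∑ v, 168 * ((G.degree v : ℤ) - 6) + ∑ d : G.Dart, 84 * ((P.nonTri d).toNat : ℤ) < 0 := by
  classical
  have hE := P.isPlanar
  have hF := P.toRotationSystem.card_facialWalk_le h₂
  have hD := G.dart_card_eq_twice_card_edges
  have hdeg := G.sum_degrees_eq_twice_card_edges
  have hiso : Nat.card {v : V // ∀ w, ¬ G.Adj v w} = 0 := by
    have : IsEmpty {v : V // ∀ w, ¬ G.Adj v w} := by
      refine ⟨fun ⟨v, hv⟩ => ?_⟩
      obtain ⟨w, hw⟩ := (G.degree_pos_iff_exists_adj v).mp (by have := h₂ v; omega)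
      exact hv w hw
    exact Nat.card_of_isEmpty
  have hc : 0 < Nat.card G.ConnectedComponent := by
    have : Nonempty G.ConnectedComponent := ⟨G.connectedComponentMk (Classical.arbitrary V)⟩
    exact Nat.card_pos
  have hedge : Nat.card G.edgeSet = G.edgeFinset.card := by
    rw [Nat.card_eq_fintype_card, SimpleGraph.edgeFinset_card]
  unfold RotationSystem.IsPlanar RotationSystem.eulerChar RotationSystem.numFaces at hE
  rw [hiso, hedge, Nat.card_eq_fintype_card] at hE
  rw [← Finset.mul_sum, ← Finset.mul_sum, Finset.sum_sub_distrib, ← Nat.cast_sum, hdeg,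
    ← Nat.cast_sum]
  simp only [Finset.sum_const, Finset.card_univ, nsmul_eq_mul]
  generalize ∑ d : G.Dart, (P.nonTri d).toNat = N at *
  push_cast
  -- With `E` edges, `F` facial walks and `N` non-triangular corners, `12F + N ≤ 8E`. Eliminating
  -- `F` by Euler's formula for `c` components gives `2(2E - 6|V|) + N ≤ -24c < 0`.
  omega

end Euler
-- Final charge of vertices of degree at least six
namespace RotationSystem

section Charge

variable {V : Type*} [Fintype V] {G : SimpleGraph V} [DecidableRel G.Adj]

theorem five_le_degClass {d : ℕ} (hd : 5 ≤ d) : 5 ≤ degClass d := by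
  unfold degClass; split_ifs <;> omega

open Classical in
/-- A vertex of degree at least six, different from seven, does not send more than it has. -/
theorem sum_transfer_le_of_ne_seven (R : RotationSystem G) (h₅ : ∀ v, 5 ≤ G.degree v) {v : V}
    (hv : 6 ≤ G.degree v) (h₇ : G.degree v ≠ 7) :
    ∑ e with e.fst = v, R.transfer e ≤ 168 * (G.degree v - 6) := by
  -- Start with two shares on each edge. `A e` and `B e` record the share crossing the corner after
  -- `e`, backwards and forwards respectively. What crosses corners cancels around the vertex,
  -- leaving a total of at most twice `share` times the degree.
  set A : G.Dart → ℕ := fun e => if sndClass e = 5 ∧ 6 ≤ sndClass (R.next e) then 1 else 0 with hA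
  set B : G.Dart → ℕ := fun e => if 6 ≤ sndClass e ∧ sndClass (R.next e) = 5 then 1 else 0 with hB
  have key : ∀ e : G.Dart, e.fst = v → R.transfer e +
      share (G.degree v) * (B e + A (R.next⁻¹ e)) ≤
        share (G.degree v) * (2 + A e + B (R.next⁻¹ e)) := by
    intro e he
    have hdeg : G.degree e.fst = G.degree v := degree_congr he
    have hs : 5 ≤ sndClass e := five_le_degClass (h₅ _)
    unfold transfer
    rw [hdeg, if_neg (show ¬ G.degree v = 5 by omega), if_neg h₇]
    simp only [hA, hB, next_inv]
    by_cases h : G.degree e.snd = 5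
    · have hse : sndClass e = 5 := degClass_eq_five.mpr h
      rw [if_pos h, ← Nat.mul_add]
      refine Nat.mul_le_mul_left _ ?_
      simp only [hse]
      generalize sndClass (R.next e) = x
      generalize sndClass (R.next⁻¹ e) = y
      cases h₁ : Nat.ble 6 x <;> cases h₂ : Nat.ble 6 y <;>
        simp only [Nat.ble_eq, ← Bool.not_eq_true] at h₁ h₂ <;> simp [h₁, h₂]
    · have hse : sndClass e ≠ 5 := fun h' => h (degClass_eq_five.mp h')
      rw [if_neg h, zero_add]
      refine Nat.mul_le_mul_left _ ?_
      have h₆ : 6 ≤ sndClass e := by omega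
      simp only [hse, h₆]
      split_ifs <;> simp
  have hsum := Finset.sum_le_sum (s := Finset.univ.filter fun e : G.Dart => e.fst = v)
    fun e he => key e (Finset.mem_filter.mp he).2
  rw [Finset.sum_add_distrib, ← Finset.mul_sum, ← Finset.mul_sum, Finset.sum_add_distrib,
    Finset.sum_add_distrib, Finset.sum_add_distrib, Finset.sum_const, card_fst_eq] at hsum
  have hA' := R.mirror.sum_next v A
  have hB' := R.mirror.sum_next v B
  rw [mirror_next] at hA' hB'
  rw [hA', hB'] at hsum
  have hshare := share_mul_le hv
  simp only [smul_eq_mul] at hsum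
  generalize ∑ e with e.fst = v, A e = a at *
  generalize ∑ e with e.fst = v, B e = b at *
  generalize share (G.degree v) = σ at *
  generalize ∑ e with e.fst = v, R.transfer e = t at *
  nlinarith

open Classical in
/-- A 7-vertex does not send more than it has. -/
theorem sum_transfer_le_of_eq_seven (R : RotationSystem G) (h₅ : ∀ v, 5 ≤ G.degree v) {d : G.Dart}
    (h₇ : G.degree d.fst = 7) : ∑ e with e.fst = d.fst, R.transfer e ≤ 168 := by
  rw [R.sum_fst_eq d, h₇]
  have hper := R.iterate_next_degree d
  rw [h₇] at hper
  simp only [Finset.sum_range_succ, Finset.sum_range_zero, zero_add, Function.iterate_succ_apply',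
    Function.iterate_zero_apply] at hper ⊢
  obtain ⟨x₁, e₁⟩ : ∃ x, R.next d = x := ⟨_, rfl⟩
  obtain ⟨x₂, e₂⟩ : ∃ x, R.next x₁ = x := ⟨_, rfl⟩
  obtain ⟨x₃, e₃⟩ : ∃ x, R.next x₂ = x := ⟨_, rfl⟩
  obtain ⟨x₄, e₄⟩ : ∃ x, R.next x₃ = x := ⟨_, rfl⟩
  obtain ⟨x₅, e₅⟩ : ∃ x, R.next x₄ = x := ⟨_, rfl⟩
  obtain ⟨x₆, e₆⟩ : ∃ x, R.next x₅ = x := ⟨_, rfl⟩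
  simp only [e₁, e₂, e₃, e₄, e₅, e₆] at hper ⊢
  have f₁ : x₁.fst = d.fst := by rw [← e₁, R.fst_next]
  have f₂ : x₂.fst = d.fst := by rw [← e₂, R.fst_next, f₁]
  have f₃ : x₃.fst = d.fst := by rw [← e₃, R.fst_next, f₂]
  have f₄ : x₄.fst = d.fst := by rw [← e₄, R.fst_next, f₃]
  have f₅ : x₅.fst = d.fst := by rw [← e₅, R.fst_next, f₄]
  have f₆ : x₆.fst = d.fst := by rw [← e₆, R.fst_next, f₅]
  have i₀ : R.next⁻¹ d = x₆ := by rw [← hper, inv_next]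
  have i₁ : R.next⁻¹ x₁ = d := by rw [← e₁, inv_next]
  have i₂ : R.next⁻¹ x₂ = x₁ := by rw [← e₂, inv_next]
  have i₃ : R.next⁻¹ x₃ = x₂ := by rw [← e₃, inv_next]
  have i₄ : R.next⁻¹ x₄ = x₃ := by rw [← e₄, inv_next]
  have i₅ : R.next⁻¹ x₅ = x₄ := by rw [← e₅, inv_next]
  have i₆ : R.next⁻¹ x₆ = x₅ := by rw [← e₆, inv_next]
  have g₁ := (degree_congr (G := G) f₁).trans h₇
  have g₂ := (degree_congr (G := G) f₂).trans h₇
  have g₃ := (degree_congr (G := G) f₃).trans h₇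
  have g₄ := (degree_congr (G := G) f₄).trans h₇
  have g₅ := (degree_congr (G := G) f₅).trans h₇
  have g₆ := (degree_congr (G := G) f₆).trans h₇
  have hs (x : G.Dart) : 5 ≤ sndClass x := five_le_degClass (h₅ _)
  have hc (x : G.Dart) : G.degree x.snd = 5 ↔ sndClass x = 5 := degClass_eq_five.symm
  have h := sevenGifts_le (hs d) (hs x₁) (hs x₂) (hs x₃) (hs x₄) (hs x₅) (hs x₆)
  unfold sevenGifts at h
  simp only [transfer, h₇, g₁, g₂, g₃, g₄, g₅, g₆, hc, e₁, e₂, e₃, e₄, e₅, e₆, hper, i₀, i₁, i₂,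
    i₃, i₄, i₅, i₆, if_true, Nat.reduceEqDiff, if_false]
  exact h

open Classical in
/-- The final charge of a vertex. -/
noncomputable def finalCharge (R : RotationSystem G) (v : V) : ℤ :=
  168 * ((G.degree v : ℤ) - 6) +
    ∑ e with e.fst = v, (84 * ((R.nonTri e).toNat : ℤ) + R.transfer e.symm - R.transfer e)

/-- Each transfer is counted once as received and once as sent, so reversing the darts cancels them.
-/
theorem sum_finalCharge (R : RotationSystem G) :
    ∑ v, R.finalCharge v =
      ∑ v, 168 * ((G.degree v : ℤ) - 6) + ∑ d : G.Dart, 84 * ((R.nonTri d).toNat : ℤ) := by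
  classical
  have hsymm : ∑ e : G.Dart, (R.transfer e.symm : ℤ) = ∑ e : G.Dart, (R.transfer e : ℤ) :=
    Equiv.sum_comp (SimpleGraph.Dart.symm_involutive (G := G)).toPerm
      (fun e => (R.transfer e : ℤ))
  unfold finalCharge
  rw [Finset.sum_add_distrib, Finset.sum_fiberwise (s := Finset.univ)
    (g := fun e : G.Dart => e.fst), Finset.sum_sub_distrib, Finset.sum_add_distrib, hsymm]
  ring

theorem finalCharge_nonneg_of_six_le (R : RotationSystem G) (h₅ : ∀ v, 5 ≤ G.degree v) {v : V}
    (hv : 6 ≤ G.degree v) : 0 ≤ R.finalCharge v := by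
  classical
  have hle : ∑ e with e.fst = v, R.transfer e ≤ 168 * (G.degree v - 6) := by
    by_cases h₇ : G.degree v = 7
    · obtain ⟨w, hw⟩ := (G.degree_pos_iff_exists_adj v).mp (by omega)
      have := R.sum_transfer_le_of_eq_seven h₅ (d := ⟨(v, w), hw⟩) h₇
      rw [h₇]
      exact this
    · exact R.sum_transfer_le_of_ne_seven h₅ hv h₇
  have hle' : ∑ e with e.fst = v, (R.transfer e : ℤ) ≤ 168 * ((G.degree v : ℤ) - 6) := by
    have : ((∑ e with e.fst = v, R.transfer e : ℕ) : ℤ) ≤ ((168 * (G.degree v - 6) : ℕ) : ℤ) :=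
      Int.ofNat_le.mpr hle
    push_cast [hv] at this
    exact this
  have hnn : 0 ≤ ∑ e with e.fst = v, (84 * ((R.nonTri e).toNat : ℤ) + R.transfer e.symm) :=
    Finset.sum_nonneg fun e _ => by positivity
  unfold finalCharge
  rw [Finset.sum_sub_distrib]
  linarith

end Charge

end RotationSystem
-- Final charge of vertices of degree five
theorem income_five (l r : Bool) : income 5 l r = 0 := by
  revert l r; decide

theorem income_seven_false_le (l : Bool) : income 7 l false ≤ 36 := by
  revert l; decide

theorem income_comm (d : ℕ) (l r : Bool) : income d l r = income d r l := by
  unfold income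
  rw [Bool.and_comm, Bool.or_comm, Nat.add_right_comm]

theorem incomes_reverse (a b c d e : ℕ) :
    incomes a e d c b false false false false false =
      incomes a b c d e false false false false false := by
  unfold incomes
  simp only [Bool.not_false, Bool.true_and]
  rw [income_comm a, income_comm b, income_comm c, income_comm d, income_comm e]
  ring

/-- The helped patterns have opposite neighbours 5 and 7 to 9, or 6 and 7, in this order, so at most
one direction applies and each may be treated alone. -/
theorem helpDir_eq_zero_or (z x p q y : ℕ) : helpDir z x p q y = 0 ∨ helpDir z y q p x = 0 := by
  unfold helpDir
  split_ifs <;> omega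

namespace RotationSystem

section Fan

variable {V : Type*} [Fintype V] {G : SimpleGraph V} [DecidableRel G.Adj]

/-- The five darts at a vertex of degree five, in cyclic order. -/
structure IsFan (R : RotationSystem G) (x₀ x₁ x₂ x₃ x₄ : G.Dart) : Prop where
  next₀ : R.next x₀ = x₁
  next₁ : R.next x₁ = x₂
  next₂ : R.next x₂ = x₃
  next₃ : R.next x₃ = x₄
  next₄ : R.next x₄ = x₀
  degree_eq : G.degree x₀.fst = 5

variable {R : RotationSystem G} {x₀ x₁ x₂ x₃ x₄ : G.Dart}

theorem IsFan.fst_eq (h : R.IsFan x₀ x₁ x₂ x₃ x₄) : x₁.fst = x₀.fst := by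
  rw [← h.next₀, R.fst_next]

theorem IsFan.rotate (h : R.IsFan x₀ x₁ x₂ x₃ x₄) : R.IsFan x₁ x₂ x₃ x₄ x₀ :=
  ⟨h.next₁, h.next₂, h.next₃, h.next₄, h.next₀, (degree_congr h.fst_eq).trans h.degree_eq⟩

theorem IsFan.mirror (h : R.IsFan x₀ x₁ x₂ x₃ x₄) : R.mirror.IsFan x₀ x₄ x₃ x₂ x₁ where
  next₀ := by rw [← h.next₄, mirror_next, inv_next]
  next₁ := by rw [← h.next₃, mirror_next, inv_next]
  next₂ := by rw [← h.next₂, mirror_next, inv_next]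
  next₃ := by rw [← h.next₁, mirror_next, inv_next]
  next₄ := by rw [← h.next₀, mirror_next, inv_next]
  degree_eq := h.degree_eq

theorem exists_isFan (R : RotationSystem G) (d : G.Dart) (hd : G.degree d.fst = 5) :
    ∃ x₁ x₂ x₃ x₄, R.IsFan d x₁ x₂ x₃ x₄ := by
  refine ⟨_, _, _, _, rfl, rfl, rfl, rfl, ?_, hd⟩
  have := R.iterate_next_degree d
  rwa [hd] at this

open Classical in
theorem IsFan.sum_eq {M : Type*} [AddCommMonoid M] (h : R.IsFan x₀ x₁ x₂ x₃ x₄) (f : G.Dart → M) :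
    ∑ e with e.fst = x₀.fst, f e = f x₀ + f x₁ + f x₂ + f x₃ + f x₄ := by
  rw [R.sum_fst_eq x₀, h.degree_eq]
  simp only [Finset.sum_range_succ, Finset.sum_range_zero, zero_add, Function.iterate_succ_apply',
    Function.iterate_zero_apply, h.next₀, h.next₁, h.next₂, h.next₃]

/-- What the center of a fan receives. -/
noncomputable def received (R : RotationSystem G) (x₀ x₁ x₂ x₃ x₄ : G.Dart) : ℕ :=
  R.transfer x₀.symm + R.transfer x₁.symm + R.transfer x₂.symm + R.transfer x₃.symm +
    R.transfer x₄.symm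

theorem IsFan.finalCharge_eq (h : R.IsFan x₀ x₁ x₂ x₃ x₄) :
    R.finalCharge x₀.fst = -168 +
      84 * ((R.nonTri x₀).toNat + (R.nonTri x₁).toNat + (R.nonTri x₂).toNat +
        (R.nonTri x₃).toNat + (R.nonTri x₄).toNat) + R.received x₀ x₁ x₂ x₃ x₄ -
      outlays (sndClass x₀) (sndClass x₁) (sndClass x₂) (sndClass x₃) (sndClass x₄) (R.nonTri x₀)
        (R.nonTri x₁) (R.nonTri x₂) (R.nonTri x₃) (R.nonTri x₄) := by
  have r₁ := h.rotate
  have r₂ := r₁.rotate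
  have r₃ := r₂.rotate
  have r₄ := r₃.rotate
  unfold finalCharge received outlays
  rw [h.sum_eq, h.degree_eq,
    ← R.transfer_eq_outlay h.next₀ h.next₁ h.next₃ h.next₄ h.degree_eq,
    ← R.transfer_eq_outlay r₁.next₀ r₁.next₁ r₁.next₃ r₁.next₄ r₁.degree_eq,
    ← R.transfer_eq_outlay r₂.next₀ r₂.next₁ r₂.next₃ r₂.next₄ r₂.degree_eq,
    ← R.transfer_eq_outlay r₃.next₀ r₃.next₁ r₃.next₃ r₃.next₄ r₃.degree_eq,
    ← R.transfer_eq_outlay r₄.next₀ r₄.next₁ r₄.next₃ r₄.next₄ r₄.degree_eq]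
  push_cast
  ring

theorem IsFan.income_le (h : R.IsFan x₀ x₁ x₂ x₃ x₄) :
    income (sndClass x₀) (!R.nonTri x₄ && Nat.ble 6 (sndClass x₄))
      (!R.nonTri x₀ && Nat.ble 6 (sndClass x₁)) ≤ R.transfer x₀.symm := by
  have := R.income_le_transfer h.degree_eq
  have h₄ : R.next⁻¹ x₀ = x₄ := h.mirror.next₀
  rwa [h.next₀, h₄] at this

theorem IsFan.incomes_le (h : R.IsFan x₀ x₁ x₂ x₃ x₄) :
    incomes (sndClass x₀) (sndClass x₁) (sndClass x₂) (sndClass x₃) (sndClass x₄) (R.nonTri x₀)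
      (R.nonTri x₁) (R.nonTri x₂) (R.nonTri x₃) (R.nonTri x₄) ≤ R.received x₀ x₁ x₂ x₃ x₄ := by
  unfold incomes received
  have h₀ := h.income_le
  have h₁ := h.rotate.income_le
  have h₂ := h.rotate.rotate.income_le
  have h₃ := h.rotate.rotate.rotate.income_le
  have h₄ := h.rotate.rotate.rotate.rotate.income_le
  omega

/-- Help is never counted twice: help from 5-neighbours adds to an income of 0, and a 7-vertex
paying 42 was counted with at most 36 because one of its flanks has degree 5. -/
theorem IsFan.incomes_add_help_le (h : R.IsFan x₀ x₁ x₂ x₃ x₄) (t₀ : R.nonTri x₀ = false)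
    (t₁ : R.nonTri x₁ = false) (t₂ : R.nonTri x₂ = false) (t₃ : R.nonTri x₃ = false)
    (t₄ : R.nonTri x₄ = false)
    (hz : sndClass x₁ ≤ 5 → sndClass x₂ ≤ 6 → sndClass x₃ ≤ 7 → sndClass x₄ ≤ 5 →
      24 ≤ sndClass x₀) :
    incomes (sndClass x₀) (sndClass x₁) (sndClass x₂) (sndClass x₃) (sndClass x₄) false false false
      false false + helpDir (sndClass x₀) (sndClass x₁) (sndClass x₂) (sndClass x₃) (sndClass x₄) ≤
      R.received x₀ x₁ x₂ x₃ x₄ := by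
  have hall := h.incomes_le
  have h₀ := h.income_le
  have h₁ := h.rotate.income_le
  have h₂ := h.rotate.rotate.income_le
  have h₃ := h.rotate.rotate.rotate.income_le
  have h₄ := h.rotate.rotate.rotate.rotate.income_le
  rw [t₀, t₁, t₂, t₃, t₄] at hall
  simp only [t₀, t₁, t₂, t₃, t₄] at h₀ h₁ h₂ h₃ h₄
  rcases R.help_le_transfer h.next₀ h.next₁ h.next₂ h.next₃ h.next₄ h.degree_eq
    (nonTri_eq_false.mp t₀) (nonTri_eq_false.mp t₁) (nonTri_eq_false.mp t₂)
    (nonTri_eq_false.mp t₃) (nonTri_eq_false.mp t₄) hz with hh | ⟨a₁, a₂, hh⟩ | ⟨a₃, a₄, hh, ht⟩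
  · omega
  · unfold incomes received
    have i₁ (l r : Bool) : income (sndClass x₁) l r = 0 := by rw [a₁, income_five]
    have i₂ (l r : Bool) : income (sndClass x₂) l r = 0 := by rw [a₂, income_five]
    rw [i₁, i₂]
    omega
  · unfold incomes received
    have h36 := income_seven_false_le (!false && Nat.ble 6 (sndClass x₂))
    rw [hh, a₄, income_five]
    rw [a₄] at h₀ h₃
    rw [a₃] at h₃ ⊢
    have hf : (!false && Nat.ble 6 5) = false := rfl
    rw [hf] at h₀ h₃ ⊢
    rw [a₃] at h₂
    omega

/-- What is known about the fans of a plane graph without the stars in question. -/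
structure HeavyFans (R : RotationSystem G) : Prop where
  heavy : ∀ {x₀ x₁ x₂ x₃ x₄}, R.IsFan x₀ x₁ x₂ x₃ x₄ →
    41 ≤ sndClass x₀ + sndClass x₁ + sndClass x₂ + sndClass x₃ + sndClass x₄ ∨ 18 ≤ sndClass x₀ ∨
      18 ≤ sndClass x₁ ∨ 18 ≤ sndClass x₂ ∨ 18 ≤ sndClass x₃ ∨ 18 ≤ sndClass x₄
  not_five_six_six_five : ∀ {x₀ x₁ x₂ x₃ x₄}, R.IsFan x₀ x₁ x₂ x₃ x₄ →
    ¬ (sndClass x₁ ≤ 5 ∧ sndClass x₂ ≤ 6 ∧ sndClass x₃ ≤ 6 ∧ sndClass x₄ ≤ 5)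
  not_five_six_seven_five : ∀ {x₀ x₁ x₂ x₃ x₄}, R.IsFan x₀ x₁ x₂ x₃ x₄ →
    ¬ (sndClass x₀ ≤ 23 ∧ sndClass x₁ ≤ 5 ∧ sndClass x₂ ≤ 6 ∧ sndClass x₃ ≤ 7 ∧ sndClass x₄ ≤ 5)
  not_five_seven_six_five : ∀ {x₀ x₁ x₂ x₃ x₄}, R.IsFan x₀ x₁ x₂ x₃ x₄ →
    ¬ (sndClass x₀ ≤ 23 ∧ sndClass x₁ ≤ 5 ∧ sndClass x₂ ≤ 7 ∧ sndClass x₃ ≤ 6 ∧ sndClass x₄ ≤ 5)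

theorem IsFan.finalCharge_nonneg_of_triangular (h : R.IsFan x₀ x₁ x₂ x₃ x₄) (H : R.HeavyFans)
    (h₅ : ∀ v, 5 ≤ G.degree v) (t₀ : R.nonTri x₀ = false) (t₁ : R.nonTri x₁ = false)
    (t₂ : R.nonTri x₂ = false) (t₃ : R.nonTri x₃ = false) (t₄ : R.nonTri x₄ = false)
    (m₁ : sndClass x₁ ≤ sndClass x₀) (m₂ : sndClass x₂ ≤ sndClass x₀)
    (m₃ : sndClass x₃ ≤ sndClass x₀) (m₄ : sndClass x₄ ≤ sndClass x₀) :
    0 ≤ R.finalCharge x₀.fst := by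
  have hm (x : G.Dart) : sndClass x ∈ degClasses := degClass_mem (h₅ _)
  have n₁ := H.not_five_six_six_five h
  have n₂ := H.not_five_six_seven_five h
  have n₃ := H.not_five_seven_six_five h
  have hheavy := H.heavy h
  have key := outlays_le_incomes_of_triangular (hm x₀) (hm x₁) (hm x₂) (hm x₃) (hm x₄) m₁ m₂ m₃ m₄
    (by omega) n₁ n₂ n₃
  have hdir := h.incomes_add_help_le t₀ t₁ t₂ t₃ t₄ (by omega)
  have hmirror : incomes (sndClass x₀) (sndClass x₁) (sndClass x₂) (sndClass x₃) (sndClass x₄)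
      false false false false false +
      helpDir (sndClass x₀) (sndClass x₄) (sndClass x₃) (sndClass x₂) (sndClass x₁) ≤
        R.received x₀ x₁ x₂ x₃ x₄ := by
    have ht {x y : G.Dart} (hxy : R.next x = y) (hx : R.nonTri x = false) :
        R.mirror.nonTri y = false := by
      rw [mirror_nonTri, ← hxy, inv_next, hx]
    have hd := h.mirror.incomes_add_help_le (ht h.next₄ t₄) (ht h.next₃ t₃) (ht h.next₂ t₂)
      (ht h.next₁ t₁) (ht h.next₀ t₀) (by omega)
    rw [incomes_reverse] at hd
    simp only [received, mirror_transfer] at hd ⊢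
    omega
  rw [h.finalCharge_eq, t₀, t₁, t₂, t₃, t₄]
  simp only [Bool.toNat_false]
  rcases helpDir_eq_zero_or (sndClass x₀) (sndClass x₁) (sndClass x₂) (sndClass x₃)
    (sndClass x₄) with hz | hz <;> omega

theorem IsFan.finalCharge_nonneg_of_nontriangular (h : R.IsFan x₀ x₁ x₂ x₃ x₄) (H : R.HeavyFans)
    (h₅ : ∀ v, 5 ≤ G.degree v) (t₀ : R.nonTri x₀ = false) (t₁ : R.nonTri x₁ = false)
    (t₂ : R.nonTri x₂ = false) (t₃ : R.nonTri x₃ = false) (t₄ : R.nonTri x₄ = true) :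
    0 ≤ R.finalCharge x₀.fst := by
  have hm (x : G.Dart) : sndClass x ∈ degClasses := degClass_mem (h₅ _)
  -- The unrestricted entry of the excluded star is `x₂`, the neighbour opposite the non-triangular
  -- corner.
  have n₁ := H.not_five_six_six_five h.rotate.rotate
  have key := outlays_le_incomes_of_nontriangular (hm x₀) (hm x₁) (hm x₂) (hm x₃) (hm x₄)
    (H.heavy h) (by omega)
  have hall := h.incomes_le
  rw [t₀, t₁, t₂, t₃, t₄] at hall
  rw [h.finalCharge_eq, t₀, t₁, t₂, t₃, t₄]
  simp only [Bool.toNat_false, Bool.toNat_true]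
  omega

theorem IsFan.finalCharge_nonneg_of_two_nontriangular (h : R.IsFan x₀ x₁ x₂ x₃ x₄)
    (H : R.HeavyFans) (h₅ : ∀ v, 5 ≤ G.degree v)
    (ht : 2 ≤ (R.nonTri x₀).toNat + (R.nonTri x₁).toNat + (R.nonTri x₂).toNat +
      (R.nonTri x₃).toNat + (R.nonTri x₄).toNat) :
    0 ≤ R.finalCharge x₀.fst := by
  have hm (x : G.Dart) : sndClass x ∈ degClasses := degClass_mem (h₅ _)
  have key := outlays_le_incomes_of_two_nontriangular (hm x₀) (hm x₁) (hm x₂) (hm x₃) (hm x₄)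
    (H.heavy h) (R.nonTri x₀) (R.nonTri x₁) (R.nonTri x₂) (R.nonTri x₃) (R.nonTri x₄)
  have hall := h.incomes_le
  rw [h.finalCharge_eq]
  omega

theorem IsFan.finalCharge_nonneg (h : R.IsFan x₀ x₁ x₂ x₃ x₄) (H : R.HeavyFans)
    (h₅ : ∀ v, 5 ≤ G.degree v) : 0 ≤ R.finalCharge x₀.fst := by
  have r₁ := h.rotate
  have r₂ := r₁.rotate
  have r₃ := r₂.rotate
  have r₄ := r₃.rotate
  have f₁ : x₁.fst = x₀.fst := h.fst_eq
  have f₂ : x₂.fst = x₀.fst := r₁.fst_eq.trans f₁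
  have f₃ : x₃.fst = x₀.fst := r₂.fst_eq.trans f₂
  have f₄ : x₄.fst = x₀.fst := r₃.fst_eq.trans f₃
  by_cases ht : 2 ≤ (R.nonTri x₀).toNat + (R.nonTri x₁).toNat + (R.nonTri x₂).toNat +
      (R.nonTri x₃).toNat + (R.nonTri x₄).toNat
  · exact h.finalCharge_nonneg_of_two_nontriangular H h₅ ht
  cases t₀ : R.nonTri x₀ <;> cases t₁ : R.nonTri x₁ <;> cases t₂ : R.nonTri x₂ <;>
    cases t₃ : R.nonTri x₃ <;> cases t₄ : R.nonTri x₄ <;>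
    first
    | (exfalso; simp [t₀, t₁, t₂, t₃, t₄] at ht; done)
    | exact h.finalCharge_nonneg_of_nontriangular H h₅ t₀ t₁ t₂ t₃ t₄
    | exact f₁ ▸ r₁.finalCharge_nonneg_of_nontriangular H h₅ t₁ t₂ t₃ t₄ t₀
    | exact f₂ ▸ r₂.finalCharge_nonneg_of_nontriangular H h₅ t₂ t₃ t₄ t₀ t₁
    | exact f₃ ▸ r₃.finalCharge_nonneg_of_nontriangular H h₅ t₃ t₄ t₀ t₁ t₂
    | exact f₄ ▸ r₄.finalCharge_nonneg_of_nontriangular H h₅ t₄ t₀ t₁ t₂ t₃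
    | skip
  -- Only the case of five triangular corners is left; rotate so that a largest class comes first.
  have hmax : ∀ a b c d e : ℕ, (b ≤ a ∧ c ≤ a ∧ d ≤ a ∧ e ≤ a) ∨ (c ≤ b ∧ d ≤ b ∧ e ≤ b ∧ a ≤ b) ∨
      (d ≤ c ∧ e ≤ c ∧ a ≤ c ∧ b ≤ c) ∨ (e ≤ d ∧ a ≤ d ∧ b ≤ d ∧ c ≤ d) ∨
      (a ≤ e ∧ b ≤ e ∧ c ≤ e ∧ d ≤ e) := by omega
  rcases hmax (sndClass x₀) (sndClass x₁) (sndClass x₂) (sndClass x₃) (sndClass x₄) with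
    ⟨a, b, c, d⟩ | ⟨a, b, c, d⟩ | ⟨a, b, c, d⟩ | ⟨a, b, c, d⟩ | ⟨a, b, c, d⟩
  · exact h.finalCharge_nonneg_of_triangular H h₅ t₀ t₁ t₂ t₃ t₄ a b c d
  · exact f₁ ▸ r₁.finalCharge_nonneg_of_triangular H h₅ t₁ t₂ t₃ t₄ t₀ a b c d
  · exact f₂ ▸ r₂.finalCharge_nonneg_of_triangular H h₅ t₂ t₃ t₄ t₀ t₁ a b c d
  · exact f₃ ▸ r₃.finalCharge_nonneg_of_triangular H h₅ t₃ t₄ t₀ t₁ t₂ a b c d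
  · exact f₄ ▸ r₄.finalCharge_nonneg_of_triangular H h₅ t₄ t₀ t₁ t₂ t₃ a b c d

end Fan

end RotationSystem

/-! ### From fans back to stars -/

section Stars

variable {V : Type*} [Fintype V] {G : SimpleGraph V} [DecidableRel G.Adj]

open RotationSystem

theorem degClass_le_iff {d k : ℕ} (hk : k ≤ 17 ∨ k = 23) : degClass d ≤ k ↔ d ≤ k := by
  unfold degClass; split_ifs <;> omega

/-- A fan all of whose neighbours are light and low provides a light and low star. -/
theorem RotationSystem.IsFan.exists_star {R : RotationSystem G} {x₀ x₁ x₂ x₃ x₄ : G.Dart}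
    (h : R.IsFan x₀ x₁ x₂ x₃ x₄)
    (hsum : sndClass x₀ + sndClass x₁ + sndClass x₂ + sndClass x₃ + sndClass x₄ ≤ 40)
    (m₀ : sndClass x₀ ≤ 17) (m₁ : sndClass x₁ ≤ 17) (m₂ : sndClass x₂ ≤ 17)
    (m₃ : sndClass x₃ ≤ 17) (m₄ : sndClass x₄ ≤ 17) :
    ∃ S : StarIn G, S.IsKStar 5 ∧ S.IsMinor ∧ S.weight ≤ 45 ∧ S.height ≤ 17 := by
  classical
  have hlow {x : G.Dart} (hx : sndClass x ≤ 17) : G.degree x.snd ≤ 17 :=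
    (degClass_le_iff (Or.inl le_rfl)).mp hx
  have hdeg {x : G.Dart} (hx : sndClass x ≤ 17) : G.degree x.snd = sndClass x := by
    have := hlow hx
    unfold sndClass degClass
    rw [if_neg (by omega), if_neg (by omega)]
  have hinj : Set.InjOn (fun e : G.Dart => e.snd)
      (Finset.univ.filter fun e : G.Dart => e.fst = x₀.fst) := by
    intro a ha b hb hab
    simp only [Finset.coe_filter, Finset.mem_univ, true_and, Set.mem_ofPred_eq] at ha hb
    exact SimpleGraph.Dart.ext _ _ (Prod.ext (ha.trans hb.symm) hab)
  have himage : G.neighborFinset x₀.fst =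
      (Finset.univ.filter fun e : G.Dart => e.fst = x₀.fst).image fun e => e.snd := by
    ext w
    simp only [SimpleGraph.mem_neighborFinset, Finset.mem_image, Finset.mem_filter,
      Finset.mem_univ, true_and]
    constructor
    · intro hw
      exact ⟨⟨(x₀.fst, w), hw⟩, rfl, rfl⟩
    · rintro ⟨e, he, rfl⟩
      rw [← he]
      exact e.adj
  have hheight : ∀ w ∈ G.neighborFinset x₀.fst, G.degree w ≤ 17 := by
    have hle : ∀ e : G.Dart, e.fst = x₀.fst → G.degree e.snd ≤ 17 := by
      -- The indicator of degree at least 18 sums to zero over the fan, so it vanishes at every dart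
      -- of the center.
      have hall := h.sum_eq fun e => if 18 ≤ G.degree e.snd then 1 else 0
      have l₀ := hlow m₀
      have l₁ := hlow m₁
      have l₂ := hlow m₂
      have l₃ := hlow m₃
      have l₄ := hlow m₄
      rw [if_neg (by omega), if_neg (by omega), if_neg (by omega), if_neg (by omega),
        if_neg (by omega)] at hall
      simp only [add_zero, Finset.sum_eq_zero_iff] at hall
      intro e he
      have := hall e (by simp [he])
      split_ifs at this
      omega
    intro w hw
    rw [SimpleGraph.mem_neighborFinset] at hw
    exact hle ⟨(x₀.fst, w), hw⟩ rfl
  refine ⟨⟨x₀.fst, G.neighborFinset x₀.fst, fun u hu => (G.mem_neighborFinset _ _).mp hu⟩,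
    h.degree_eq, h.degree_eq.le, ?_, ?_⟩
  · unfold StarIn.weight
    simp only
    rw [h.degree_eq, himage, Finset.sum_image hinj, h.sum_eq, hdeg m₀, hdeg m₁, hdeg m₂, hdeg m₃,
      hdeg m₄]
    omega
  · unfold StarIn.height
    simp only
    rw [h.degree_eq]
    exact max_le (by norm_num) (Finset.sup_le hheight)

theorem PlaneEmbedding.hasCyclicStar_of_isFan (P : PlaneEmbedding G) {x₀ x₁ x₂ x₃ x₄ : G.Dart}
    (h : P.IsFan x₀ x₁ x₂ x₃ x₄ ∨ P.mirror.IsFan x₀ x₁ x₂ x₃ x₄) {k₀ k₁ k₂ k₃ k₄ : ℕ∞}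
    (h₀ : (G.degree x₀.snd : ℕ∞) ≤ k₀) (h₁ : (G.degree x₁.snd : ℕ∞) ≤ k₁)
    (h₂ : (G.degree x₂.snd : ℕ∞) ≤ k₂) (h₃ : (G.degree x₃.snd : ℕ∞) ≤ k₃)
    (h₄ : (G.degree x₄.snd : ℕ∞) ≤ k₄) : P.HasCyclicStar ![k₀, k₁, k₂, k₃, k₄] := by
  have key : ∀ R : RotationSystem G, R.IsFan x₀ x₁ x₂ x₃ x₄ → ∀ i : Fin 5,
      (G.degree ((R.next ^ (i : ℕ)) x₀).snd : ℕ∞) ≤ ![k₀, k₁, k₂, k₃, k₄] i := by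
    intro R hR i
    fin_cases i
    · exact h₀
    · change (G.degree (R.next x₀).snd : ℕ∞) ≤ k₁
      rwa [hR.next₀]
    · change (G.degree (R.next (R.next x₀)).snd : ℕ∞) ≤ k₂
      rwa [hR.next₀, hR.next₁]
    · change (G.degree (R.next (R.next (R.next x₀))).snd : ℕ∞) ≤ k₃
      rwa [hR.next₀, hR.next₁, hR.next₂]
    · change (G.degree (R.next (R.next (R.next (R.next x₀)))).snd : ℕ∞) ≤ k₄
      rwa [hR.next₀, hR.next₁, hR.next₂, hR.next₃]
  rcases h with h | h
  · exact ⟨x₀, h.degree_eq, Or.inl (key _ h)⟩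
  · have hm := key _ h
    rw [mirror_next] at hm
    exact ⟨x₀, h.degree_eq, Or.inr hm⟩

theorem PlaneEmbedding.heavyFans (P : PlaneEmbedding G)
    (h₁ : ¬ P.HasCyclicStar ![5, 6, 6, 5, ⊤]) (h₂ : ¬ P.HasCyclicStar ![5, 6, 7, 5, 23])
    (hstar : ¬ ∃ S : StarIn G, S.IsKStar 5 ∧ S.IsMinor ∧ S.weight ≤ 45 ∧ S.height ≤ 17) :
    P.HeavyFans := by
  have le₅ {x : G.Dart} (hx : sndClass x ≤ 5) : (G.degree x.snd : ℕ∞) ≤ 5 := by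
    exact_mod_cast (degClass_le_iff (by norm_num)).mp hx
  have le₆ {x : G.Dart} (hx : sndClass x ≤ 6) : (G.degree x.snd : ℕ∞) ≤ 6 := by
    exact_mod_cast (degClass_le_iff (by norm_num)).mp hx
  have le₇ {x : G.Dart} (hx : sndClass x ≤ 7) : (G.degree x.snd : ℕ∞) ≤ 7 := by
    exact_mod_cast (degClass_le_iff (by norm_num)).mp hx
  have le₂₃ {x : G.Dart} (hx : sndClass x ≤ 23) : (G.degree x.snd : ℕ∞) ≤ 23 := by
    exact_mod_cast (degClass_le_iff (by norm_num)).mp hx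
  constructor
  · intro x₀ x₁ x₂ x₃ x₄ h
    by_contra hn
    exact hstar (h.exists_star (by omega) (by omega) (by omega) (by omega) (by omega) (by omega))
  · rintro x₀ x₁ x₂ x₃ x₄ h ⟨a₁, a₂, a₃, a₄⟩
    exact h₁ (P.hasCyclicStar_of_isFan (Or.inl h.rotate) (le₅ a₁) (le₆ a₂)
      (le₆ a₃) (le₅ a₄) le_top)
  · rintro x₀ x₁ x₂ x₃ x₄ h ⟨a₀, a₁, a₂, a₃, a₄⟩
    exact h₂ (P.hasCyclicStar_of_isFan (Or.inl h.rotate) (le₅ a₁) (le₆ a₂)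
      (le₇ a₃) (le₅ a₄) (le₂₃ a₀))
  -- The excluded star is read in the opposite sense, hence the mirror image.
  · rintro x₀ x₁ x₂ x₃ x₄ h ⟨a₀, a₁, a₂, a₃, a₄⟩
    exact h₂ (P.hasCyclicStar_of_isFan (Or.inr h.mirror.rotate) (le₅ a₄)
      (le₆ a₃) (le₇ a₂) (le₅ a₁) (le₂₃ a₀))

end Stars

end PlaneStar

theorem theorem14 {V : Type*} [Fintype V] (G : SimpleGraph V) [DecidableRel G.Adj]
    (P : PlaneStar.PlaneEmbedding G)
    (hδ : G.minDegree = 5)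
    (h₁ : ¬ P.HasCyclicStar ![5, 6, 6, 5, ⊤])
    (h₂ : ¬ P.HasCyclicStar ![5, 6, 7, 5, 23]) :
    ∃ S : PlaneStar.StarIn G,
      S.IsKStar 5 ∧ S.IsMinor ∧ S.weight ≤ 45 ∧ S.height ≤ 17 := by
  by_contra hstar
  have H := P.heavyFans h₁ h₂ hstar
  have h₅ : ∀ v, 5 ≤ G.degree v := fun v => hδ ▸ G.minDegree_le_degree v
  have hV : Nonempty V := by
    -- The minimum degree of the empty graph is 0 by convention, not 5.
    by_contra hV
    rw [not_nonempty_iff] at hV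
    rw [SimpleGraph.minDegree_of_subsingleton] at hδ
    omega
  have hneg := P.sum_charge_neg fun v => le_trans (by norm_num) (h₅ v)
  rw [← P.toRotationSystem.sum_finalCharge] at hneg
  refine absurd hneg (not_lt.mpr (Finset.sum_nonneg fun v _ => ?_))
  by_cases hv : 6 ≤ G.degree v
  · exact P.toRotationSystem.finalCharge_nonneg_of_six_le h₅ hv
  · obtain ⟨w, hw⟩ := (G.degree_pos_iff_exists_adj v).mp (by have := h₅ v; omega)
    obtain ⟨x₁, x₂, x₃, x₄, hx⟩ := P.toRotationSystem.exists_isFan ⟨(v, w), hw⟩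
      (show G.degree v = 5 by have := h₅ v; omega)
    exact hx.finalCharge_nonneg H h₅
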